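/- Let $(\Omega,\mathcal F_\infty,(\mathcal F_t)_{t\ge 0},P)$ be a complete filtered probability space whose filtration is right continuous and such that $\mathcal F_0$ is the $\sigma$-algebra generated by the $P$-null sets of $\mathcal F_\infty$. For a stopping time $\tau$ with values in $[0,\infty]$ put $\mathcal F_\tau=\{A\in\mathcal F_\infty : A\cap\{\tau\le t\}\in\mathcal F_t\ \forall t\ge 0\}$ and $L^\infty(\mathcal F_\tau)=L^\infty(\Omega,\mathcal F_\tau,P)$. A *dynamic pricing procedure* is a family of maps $\Pi_{\sigma,\tau}:L^\infty(\mathcal F_\tau)\to L^\infty(\mathcal F_\sigma)$, indexed by stopping times $\sigma\le\tau$, that are monotone, translation invariant ($\Pi_{\sigma,\tau}(X+Z)=\Pi_{\sigma,\tau}(X)+Z$ for $Z\in L^\infty(\mathcal F_\sigma)$), convex ($\Pi_{\sigma,\tau}(\lambda X+(1-\lambda)Y)\le\lambda\Pi_{\sigma,\tau}(X)+(1-\lambda)\Pi_{\sigma,\tau}(Y)$ for real $\lambda\in[0,1]$) and normalized ($\Pi_{\sigma,\tau}(0)=0$). It is *sublinear* if $\Pi_{\sigma,\tau}(\lambda X)=\lambda\Pi_{\sigma,\tau}(X)$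 for all real $\lambda>0$; *time-consistent* if $\Pi_{\nu,\sigma}(\Pi_{\sigma,\tau}(X))=\Pi_{\nu,\tau}(X)$ for all $\nu\le\sigma\le\tau$ and $X\in L^\infty(\mathcal F_\tau)$; *continuous from below* (resp. *above*) if $\Pi_{\sigma,\tau}(X_n)\to\Pi_{\sigma,\tau}(X)$ a.s. whenever $(X_n)$ is an increasing (resp. decreasing) sequence in $L^\infty(\mathcal F_\tau)$ converging a.s. to $X\in L^\infty(\mathcal F_\tau)$. A *TCPP* is a time-consistent dynamic pricing procedure that is continuous from below. For a probability measure $Q\ll P$ on $\mathcal F_\infty$ the *minimal penalty* is $$\alpha^m_{\sigma,\tau}(Q)=Q\text{-}\operatorname{ess\,sup}_{X\in L^\infty(\mathcal F_\tau)}\bigl(E_Q(X\mid\mathcal F_\sigma)-\Pi_{\sigma,\tau}(X)\bigr).$$ A dynamic pricing procedure is *non-degenerate* if every $A\in\mathcal F_\infty$ with $\Pi_{0,\infty}(-\lambda 1_A)=0$ for all $\lambda>0$ satisfies $P(A)=0$. Let $\mathcal C=\{\lambda X : \lambda\ge 0,\ X\in L^\infty(\mathcal F_\infty),\ \Pi_{0,\infty}(X)\le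 0\}$. Let $\mathcal K_0$ be the set of all $X_0+\sum_{i=1}^n(Z_i-Y_i)$ with $n\in\mathbb N$, $X_0,Y_i,Z_i\in L^\infty(\mathcal F_\infty)$ and stopping times $0\le\tau_1\le\dots\le\tau_n<\infty$ (a.s. finite) such that $\Pi_{0,\infty}(X_0)\le 0$ and $\Pi_{\tau_i,\infty}(Z_i)\le-\Pi_{\tau_i,\infty}(-Y_i)$ for all $i$; let $\mathcal K=\{\lambda X:\lambda\ge0,\ X\in\mathcal K_0\}$. The procedure has *No Static* (resp. *Multiperiod*) *Free Lunch* if the closure of $\mathcal C$ (resp. $\mathcal K$) for the weak* topology $\sigma(L^\infty(P),L^1(P))$ meets $L^\infty_+(\Omega,\mathcal F_\infty,P)$ only in $0$; it has *No Free Lunch* if it has both No Static and No Multiperiod Free Lunch. **Statement.** Let $(\Pi_{\sigma,\tau})$ be a TCPP. 1. If it is non-degenerate and there is a probability measure $Q\ll P$ with $\alpha^m_{0,\infty}(Q)=0$, then it has No Free Lunch. 2. If it is non-degenerate and sublinear, then it has No Free Lunch. 3. If it is non-degenerate and continuous from above, then it has No Free Lunch. 4. In the sublinear case the following condition, which is weaker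 than non-degeneracy, is already enough for No Free Lunch: every $A\in\mathcal F_\infty$ with $\Pi_{0,\infty}(\lambda 1_A)=0$ for all $\lambda>0$ satisfies $P(A)=0$. -/

import Mathlib

open MeasureTheory Filter Topology
open scoped NNReal ENNReal

noncomputable section

namespace DynPricing

/-- The standing assumptions on a filtered probability space with ambient `σ`-algebra
`m = F_∞` and filtration `(F_t)_{t ≥ 0}`: the probability space is complete, the filtration is
right continuous, and `F_0` is generated by the `P`-null sets of `F_∞` (so that every `F_t`
contains all the `P`-null sets). -/
structure StandingAssumptions {Ω : Type*} {m : MeasurableSpace Ω} (P : Measure Ω)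
    (𝓕 : Filtration ℝ≥0 m) : Prop where
  isComplete : P.IsComplete
  isRightContinuous : 𝓕.IsRightContinuous
  zero_eq : 𝓕 0 = MeasurableSpace.generateFrom {s : Set Ω | MeasurableSet s ∧ P s = 0}

/-- Stopping times with values in `[0, ∞]`, ordered pointwise. -/
abbrev StopTime {Ω : Type*} {m : MeasurableSpace Ω} (𝓕 : Filtration ℝ≥0 m) :=
  {τ : Ω → WithTop ℝ≥0 // IsStoppingTime 𝓕 τ}

section StopTime

variable {Ω : Type*} {m : MeasurableSpace Ω} {𝓕 : Filtration ℝ≥0 m}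

/-- The stopping time `0`. -/
def StopTime.zero (𝓕 : Filtration ℝ≥0 m) : StopTime 𝓕 :=
  ⟨fun _ => ((0 : ℝ≥0) : WithTop ℝ≥0), isStoppingTime_const 𝓕 0⟩

/-- The stopping time `∞`. -/
def StopTime.infty (𝓕 : Filtration ℝ≥0 m) : StopTime 𝓕 :=
  ⟨fun _ => ⊤, fun i => by simp⟩

theorem StopTime.zero_le (τ : StopTime 𝓕) : StopTime.zero 𝓕 ≤ τ :=
  fun ω => show (((0 : ℝ≥0) : WithTop ℝ≥0)) ≤ τ.1 ω from bot_le

theorem StopTime.le_infty (τ : StopTime 𝓕) : τ ≤ StopTime.infty 𝓕 :=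
  fun _ => le_top

/-- The `σ`-algebra `F_τ = {A ∈ F_∞ | ∀ t, A ∩ {τ ≤ t} ∈ F_t}`, where `F_∞` is the ambient
`σ`-algebra `m`. -/
abbrev StopTime.sigmaAlgebra (τ : StopTime 𝓕) : MeasurableSpace Ω where
  MeasurableSet' A := MeasurableSet[m] A ∧ ∀ t : ℝ≥0, MeasurableSet[𝓕 t] (A ∩ {ω | τ.1 ω ≤ t})
  measurableSet_empty := by simp
  measurableSet_compl A hA := by
    refine ⟨hA.1.compl, fun t => ?_⟩
    have h : Aᶜ ∩ {ω | τ.1 ω ≤ t} = {ω | τ.1 ω ≤ t} \ (A ∩ {ω | τ.1 ω ≤ t}) := by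
      ext ω; simp; tauto
    rw [h]
    exact (τ.2 t).diff (hA.2 t)
  measurableSet_iUnion A hA := by
    refine ⟨MeasurableSet.iUnion fun n => (hA n).1, fun t => ?_⟩
    rw [Set.iUnion_inter]
    exact MeasurableSet.iUnion fun n => (hA n).2 t

theorem StopTime.sigmaAlgebra_le (τ : StopTime 𝓕) : τ.sigmaAlgebra ≤ m :=
  fun _ hA => hA.1

theorem StopTime.sigmaAlgebra_mono {σ τ : StopTime 𝓕} (h : σ ≤ τ) :
    σ.sigmaAlgebra ≤ τ.sigmaAlgebra := by
  refine fun A hA => ⟨hA.1, fun t => ?_⟩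
  have h' : A ∩ {ω | τ.1 ω ≤ t} = (A ∩ {ω | σ.1 ω ≤ t}) ∩ {ω | τ.1 ω ≤ t} := by
    ext ω
    have := h ω
    simp only [Set.mem_inter_iff, Set.mem_ofPred_eq]
    exact ⟨fun hω => ⟨⟨hω.1, this.trans hω.2⟩, hω.2⟩, fun hω => ⟨hω.1.1, hω.2⟩⟩
  rw [h']
  exact (hA.2 t).inter (τ.2 t)

theorem StopTime.sigmaAlgebra_infty : (StopTime.infty 𝓕).sigmaAlgebra = m := by
  refine le_antisymm (StopTime.sigmaAlgebra_le _) fun A hA => ⟨hA, fun t => ?_⟩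
  have h : A ∩ {ω | (StopTime.infty 𝓕).1 ω ≤ t} = ∅ := by
    ext ω
    have hω : ¬ (⊤ : WithTop ℝ≥0) ≤ (t : WithTop ℝ≥0) := not_le.mpr (WithTop.coe_lt_top t)
    exact ⟨fun h => hω h.2, fun h => h.elim⟩
  rw [h]
  exact @MeasurableSet.empty _ (𝓕 t)

end StopTime

/-- `L^∞(Ω, F_τ, P)`, as the subspace of (classes of) `F_τ`-measurable functions in
`L^∞(Ω, F_∞, P)`. -/
abbrev LInf {Ω : Type*} {m : MeasurableSpace Ω} (P : Measure Ω) {𝓕 : Filtration ℝ≥0 m}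
    (τ : StopTime 𝓕) : Submodule ℝ (Lp ℝ ∞ P) :=
  lpMeas ℝ ℝ τ.sigmaAlgebra ∞ P

section LInf

variable {Ω : Type*} {m : MeasurableSpace Ω} {P : Measure Ω} {𝓕 : Filtration ℝ≥0 m}

theorem LInf.mono {σ τ : StopTime 𝓕} (h : σ ≤ τ) : LInf P σ ≤ LInf P τ := fun f hf => by
  rw [mem_lpMeas_iff_aestronglyMeasurable] at hf ⊢
  exact hf.mono (StopTime.sigmaAlgebra_mono h)

/-- The inclusion `L^∞(F_σ) ⊆ L^∞(F_τ)` for `σ ≤ τ`. -/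
def LInf.incl {σ τ : StopTime 𝓕} (h : σ ≤ τ) : LInf P σ →ₗ[ℝ] LInf P τ :=
  Submodule.inclusion (LInf.mono h)

/-- An element of `L^∞(Ω, F_∞, P)`, seen in the space attached to the stopping time `∞`. -/
def LInf.ofLp (𝓕 : Filtration ℝ≥0 m) (X : Lp ℝ ∞ P) : LInf P (StopTime.infty 𝓕) :=
  ⟨X, by
    rw [mem_lpMeas_iff_aestronglyMeasurable, StopTime.sigmaAlgebra_infty]
    exact Lp.aestronglyMeasurable X⟩

end LInf

/-- A dynamic pricing procedure `(Π_{σ,τ})_{0 ≤ σ ≤ τ}`, `σ ≤ τ` stopping times. -/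
structure PricingProcedure {Ω : Type*} {m : MeasurableSpace Ω} (P : Measure Ω)
    (𝓕 : Filtration ℝ≥0 m) where
  /-- the map `Π_{σ,τ} : L^∞(F_τ) → L^∞(F_σ)` -/
  price : ∀ {σ τ : StopTime 𝓕}, σ ≤ τ → LInf P τ → LInf P σ
  monotone : ∀ {σ τ : StopTime 𝓕} (h : σ ≤ τ) (X Y : LInf P τ),
    (X : Lp ℝ ∞ P) ≤ Y → (price h X : Lp ℝ ∞ P) ≤ price h Y
  translation : ∀ {σ τ : StopTime 𝓕} (h : σ ≤ τ) (Z : LInf P σ) (X : LInf P τ),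
    price h (X + LInf.incl h Z) = price h X + Z
  convex : ∀ {σ τ : StopTime 𝓕} (h : σ ≤ τ) (X Y : LInf P τ) (l : ℝ), 0 ≤ l → l ≤ 1 →
    (price h (l • X + (1 - l) • Y) : Lp ℝ ∞ P) ≤
      ((l • price h X + (1 - l) • price h Y : LInf P σ) : Lp ℝ ∞ P)
  normalized : ∀ {σ τ : StopTime 𝓕} (h : σ ≤ τ), price h 0 = 0

/-- `f` is (a version of) the `Q`-essential supremum of the family `S` of `[-∞, ∞]`-valued
functions. -/
def IsEssSup {Ω : Type*} {m : MeasurableSpace Ω} (Q : Measure Ω) (S : Set (Ω → EReal))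
    (f : Ω → EReal) : Prop :=
  AEMeasurable f Q ∧ (∀ g ∈ S, g ≤ᵐ[Q] f) ∧
    ∀ h : Ω → EReal, AEMeasurable h Q → (∀ g ∈ S, g ≤ᵐ[Q] h) → f ≤ᵐ[Q] h

/-- The weak* topology `σ(L^∞(P), L^1(P))` on `L^∞(P)`: the coarsest topology for which
`X ↦ E(g X)` is continuous for every `g ∈ L^1(P)`. -/
abbrev weakStar {Ω : Type*} {m : MeasurableSpace Ω} (P : Measure Ω) :
    TopologicalSpace (Lp ℝ ∞ P) :=
  ⨅ g : Lp ℝ 1 P,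
    TopologicalSpace.induced (fun X : Lp ℝ ∞ P => ∫ ω, g ω * X ω ∂P) inferInstance

namespace PricingProcedure

variable {Ω : Type*} {m : MeasurableSpace Ω} {P : Measure Ω} {𝓕 : Filtration ℝ≥0 m}

/-- `Π_{σ,∞}` on `L^∞(Ω, F_∞, P)`. -/
def priceInfty (V : PricingProcedure P 𝓕) (σ : StopTime 𝓕) (X : Lp ℝ ∞ P) : Lp ℝ ∞ P :=
  V.price σ.le_infty (LInf.ofLp 𝓕 X)

/-- `Π_{0,∞}` on `L^∞(Ω, F_∞, P)`. -/
def priceZeroInfty (V : PricingProcedure P 𝓕) (X : Lp ℝ ∞ P) : Lp ℝ ∞ P :=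
  V.priceInfty (StopTime.zero 𝓕) X

/-- Sublinearity (positive homogeneity, on top of convexity). -/
def Sublinear (V : PricingProcedure P 𝓕) : Prop :=
  ∀ {σ τ : StopTime 𝓕} (h : σ ≤ τ) (l : ℝ), 0 < l → ∀ X : LInf P τ,
    V.price h (l • X) = l • V.price h X

def TimeConsistent (V : PricingProcedure P 𝓕) : Prop :=
  ∀ {ν σ τ : StopTime 𝓕} (h₁ : ν ≤ σ) (h₂ : σ ≤ τ) (X : LInf P τ),
    V.price h₁ (V.price h₂ X) = V.price (h₁.trans h₂) X

def ContinuousFromBelow (V : PricingProcedure P 𝓕) : Prop :=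
  ∀ {σ τ : StopTime 𝓕} (h : σ ≤ τ) (Xn : ℕ → LInf P τ) (X : LInf P τ),
    Monotone (fun n => (Xn n : Lp ℝ ∞ P)) →
    (∀ᵐ ω ∂P, Tendsto (fun n => (Xn n : Lp ℝ ∞ P) ω) atTop (𝓝 ((X : Lp ℝ ∞ P) ω))) →
    ∀ᵐ ω ∂P, Tendsto (fun n => (V.price h (Xn n) : Lp ℝ ∞ P) ω) atTop
      (𝓝 ((V.price h X : Lp ℝ ∞ P) ω))

def ContinuousFromAbove (V : PricingProcedure P 𝓕) : Prop :=
  ∀ {σ τ : StopTime 𝓕} (h : σ ≤ τ) (Xn : ℕ → LInf P τ) (X : LInf P τ),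
    Antitone (fun n => (Xn n : Lp ℝ ∞ P)) →
    (∀ᵐ ω ∂P, Tendsto (fun n => (Xn n : Lp ℝ ∞ P) ω) atTop (𝓝 ((X : Lp ℝ ∞ P) ω))) →
    ∀ᵐ ω ∂P, Tendsto (fun n => (V.price h (Xn n) : Lp ℝ ∞ P) ω) atTop
      (𝓝 ((V.price h X : Lp ℝ ∞ P) ω))

/-- A TCPP: a time-consistent dynamic pricing procedure continuous from below. -/
structure IsTCPP (V : PricingProcedure P 𝓕) : Prop where
  timeConsistent : V.TimeConsistent
  continuousFromBelow : V.ContinuousFromBelow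

/-- `α` is (a version of) the minimal penalty `α^m_{σ,τ}(Q)`, that is of the `Q`-essential
supremum of `E_Q(X | F_σ) - Π_{σ,τ}(X)` over `X ∈ L^∞(F_τ)`. -/
def IsMinimalPenalty (V : PricingProcedure P 𝓕) {σ τ : StopTime 𝓕} (h : σ ≤ τ)
    (Q : Measure Ω) (α : Ω → EReal) : Prop :=
  IsEssSup Q {g | ∃ X : LInf P τ, g = fun ω =>
    ((Q[(X : Lp ℝ ∞ P) | σ.sigmaAlgebra] ω - (V.price h X : Lp ℝ ∞ P) ω : ℝ) : EReal)} α

/-- `α^m_{0,∞}(Q) = 0`. -/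
def HasZeroMinimalPenalty (V : PricingProcedure P 𝓕) (Q : Measure Ω) : Prop :=
  V.IsMinimalPenalty (StopTime.zero 𝓕).le_infty Q (fun _ => 0)

/-- Non-degeneracy: an event `A` with zero bid price `-Π_{0,∞}(-λ 1_A)` for all `λ > 0` is null.
In terms of the risk measure `ρ(X) = Π(-X)` the premise reads `ρ_{0,∞}(λ 1_A) = 0`. -/
def NonDegenerate [IsFiniteMeasure P] (V : PricingProcedure P 𝓕) : Prop :=
  ∀ (A : Set Ω) (hA : MeasurableSet A),
    (∀ l : ℝ, 0 < l →
      V.priceZeroInfty (-(l • indicatorConstLp ∞ hA (measure_ne_top P A) (1 : ℝ))) = 0) →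
    P A = 0

/-- The weaker condition that an event `A` with zero ask price `Π_{0,∞}(λ 1_A)` for all `λ > 0`
is null. -/
def AskNonDegenerate [IsFiniteMeasure P] (V : PricingProcedure P 𝓕) : Prop :=
  ∀ (A : Set Ω) (hA : MeasurableSet A),
    (∀ l : ℝ, 0 < l →
      V.priceZeroInfty (l • indicatorConstLp ∞ hA (measure_ne_top P A) (1 : ℝ)) = 0) →
    P A = 0

/-- `C = {λ X | λ ≥ 0, X ∈ L^∞(F_∞), Π_{0,∞}(X) ≤ 0}`. -/
def coneC (V : PricingProcedure P 𝓕) : Set (Lp ℝ ∞ P) :=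
  {W | ∃ (l : ℝ) (X : Lp ℝ ∞ P), 0 ≤ l ∧ V.priceZeroInfty X ≤ 0 ∧ W = l • X}

/-- The set `K_0` of financial products attainable at zero cost via simple strategies. -/
def zeroCost (V : PricingProcedure P 𝓕) : Set (Lp ℝ ∞ P) :=
  {W | ∃ (n : ℕ) (τ : Fin n → StopTime 𝓕) (X₀ : Lp ℝ ∞ P) (Y Z : Fin n → Lp ℝ ∞ P),
    Monotone τ ∧ (∀ i, ∀ᵐ ω ∂P, (τ i).1 ω < ⊤) ∧
    V.priceZeroInfty X₀ ≤ 0 ∧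
    (∀ i, V.priceInfty (τ i) (Z i) ≤ -V.priceInfty (τ i) (-(Y i))) ∧
    W = X₀ + ∑ i, (Z i - Y i)}

/-- `K = {λ X | λ ≥ 0, X ∈ K_0}`. -/
def coneK (V : PricingProcedure P 𝓕) : Set (Lp ℝ ∞ P) :=
  {W | ∃ (l : ℝ) (X : Lp ℝ ∞ P), 0 ≤ l ∧ X ∈ V.zeroCost ∧ W = l • X}

def NoStaticFreeLunch (V : PricingProcedure P 𝓕) : Prop :=
  @closure _ (weakStar P) V.coneC ∩ {X | 0 ≤ X} = {0}

def NoMultiperiodFreeLunch (V : PricingProcedure P 𝓕) : Prop :=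
  @closure _ (weakStar P) V.coneK ∩ {X | 0 ≤ X} = {0}

/-- No Free Lunch, in both the static and the multiperiod sense. -/
def NoFreeLunch (V : PricingProcedure P 𝓕) : Prop :=
  V.NoStaticFreeLunch ∧ V.NoMultiperiodFreeLunch

end PricingProcedure

end DynPricing

end

/-! Since `F_0` is trivial modulo `P`, the time-0 price is a number `p X` (`value`). No Free Lunch
follows once every event `A` with `P A ≠ 0` is charged by a probability `Q ≪ P` with `E_Q ≤ p` on
`L^∞` (`noFreeLunch_of_forall_exists`). Indeed `E_Q` is weak* continuous and nonpositive on `C`. It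
is also nonpositive on `K`: by time-consistency `X - Π_{τ,∞}(X)` has price zero, so `E_Q X ≤ E_Q
Π_{τ,∞}(X)`, and each trade `Z_i - Y_i` has nonpositive expectation. A nonnegative `X` in either
closure then has `E_Q X ≤ 0`, which is impossible if `Q` charges `{X > 0}`.

Under non-degeneracy a single dominated `Q` charges every non-null event. A zero penalty says
exactly that `Q` is dominated; continuity from above yields such a `Q` by Hahn–Banach.

The sublinear case has only continuity from below, so a separating functional need not be countably
additive. `exists_measure_pos` separates `{p < 0}` from a convex set `x₀ - U`, with `U` a modular
ball of a Young function that contains large multiples of indicators of small events; this forces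
countable additivity. The Young function is built level by level (`Detects.exists_succ`) from a
Fatou property and a convex selection argument in `L²`. The resulting `Q` depends on `A`, which the
criterion allows. -/

namespace DynPricing

/-! ### Probability measures from positive functionals on `L^∞`. -/

section Representation

variable {Ω : Type*} {m : MeasurableSpace Ω} {P : Measure Ω}

theorem ae_abs_le_norm (X : Lp ℝ ∞ P) : ∀ᵐ ω ∂P, |X ω| ≤ ‖X‖ := by
  have h := enorm_ae_le_eLpNormEssSup (X : Ω → ℝ) P
  filter_upwards [h] with ω hω
  have h2 : ENNReal.ofReal |X ω| ≤ ENNReal.ofReal ‖X‖ := by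
    rw [Lp.norm_def, ENNReal.ofReal_toReal (Lp.eLpNorm_ne_top X), eLpNorm_exponent_top]
    rwa [← Real.norm_eq_abs, ofReal_norm]
  exact (ENNReal.ofReal_le_ofReal_iff (norm_nonneg _)).1 h2

theorem smul_nonneg_linfty {a : ℝ} (ha : 0 ≤ a) {X : Lp ℝ ∞ P} (hX : 0 ≤ X) : 0 ≤ a • X := by
  rw [← Lp.coeFn_nonneg] at hX ⊢
  filter_upwards [hX, Lp.coeFn_smul a X] with ω h1 h2
  rw [h2]
  exact mul_nonneg ha h1

theorem integrable_linfty [IsFiniteMeasure P] (X : Lp ℝ ∞ P) : Integrable X P :=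
  Integrable.of_bound (Lp.aestronglyMeasurable X) ‖X‖ (ae_abs_le_norm X)

theorem integrable_linfty_of_ac {Q : Measure Ω} [IsFiniteMeasure Q] (hQ : Q ≪ P)
    (X : Lp ℝ ∞ P) : Integrable X Q :=
  Integrable.of_bound ((Lp.aestronglyMeasurable X).mono_ac hQ) ‖X‖
    (hQ.ae_le (ae_abs_le_norm X))

variable [IsFiniteMeasure P]

/-- The class of the indicator function of an event. -/
noncomputable abbrev ind (P : Measure Ω) [IsFiniteMeasure P] {A : Set Ω} (hA : MeasurableSet A) :
    Lp ℝ ∞ P :=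
  indicatorConstLp ∞ hA (measure_ne_top P A) (1 : ℝ)

theorem ind_nonneg {A : Set Ω} (hA : MeasurableSet A) : 0 ≤ ind P hA := by
  rw [← Lp.coeFn_nonneg]
  filter_upwards [indicatorConstLp_coeFn (p := ∞) (hs := hA) (hμs := measure_ne_top P A)
    (c := (1 : ℝ))] with ω hω
  rw [hω]
  exact Set.indicator_nonneg (fun _ _ => zero_le_one) ω

theorem coeFn_const_one_smul (c : ℝ) : ∀ᵐ ω ∂P, (c • Lp.const ∞ P (1 : ℝ)) ω = c := by
  filter_upwards [Lp.coeFn_smul c (Lp.const ∞ P (1 : ℝ)), Lp.coeFn_const ∞ P (1 : ℝ)] with ω h1 h2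
  rw [h1, Pi.smul_apply, h2]; simp

theorem le_smul_one {X : Lp ℝ ∞ P} {c : ℝ} (h : ∀ᵐ ω ∂P, X ω ≤ c) :
    X ≤ c • Lp.const ∞ P (1 : ℝ) := by
  rw [← Lp.coeFn_le]
  filter_upwards [h, coeFn_const_one_smul (P := P) c] with ω h1 h2
  rwa [h2]

theorem smul_one_le {X : Lp ℝ ∞ P} {c : ℝ} (h : ∀ᵐ ω ∂P, c ≤ X ω) :
    c • Lp.const ∞ P (1 : ℝ) ≤ X := by
  rw [← Lp.coeFn_le]
  filter_upwards [h, coeFn_const_one_smul (P := P) c] with ω h1 h2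
  rwa [h2]

theorem abs_le_of_positive (l : Lp ℝ ∞ P →ₗ[ℝ] ℝ) (hpos : ∀ X, 0 ≤ X → 0 ≤ l X)
    (h1 : l (Lp.const ∞ P (1 : ℝ)) = 1) {X : Lp ℝ ∞ P} {c : ℝ} (h : ∀ᵐ ω ∂P, |X ω| ≤ c) :
    |l X| ≤ c := by
  have hu : X ≤ c • Lp.const ∞ P (1 : ℝ) := le_smul_one (h.mono fun _ h => (abs_le.1 h).2)
  have hl : (-c) • Lp.const ∞ P (1 : ℝ) ≤ X := smul_one_le (h.mono fun _ h => (abs_le.1 h).1)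
  have h2 := hpos _ (sub_nonneg.2 hu)
  have h3 := hpos _ (sub_nonneg.2 hl)
  rw [map_sub, map_smul, h1, smul_eq_mul] at h2 h3
  rw [abs_le]
  constructor <;> linarith

/-- By finite additivity the partial sums miss the total by the value on the tail `⋃ i ≥ n, f i`;
disjointness makes these tails decrease to `∅`. -/
theorem hasSum_ind (l : Lp ℝ ∞ P →ₗ[ℝ] ℝ) (hpos : ∀ X, 0 ≤ X → 0 ≤ l X)
    (hcont : ∀ (A : ℕ → Set Ω) (hA : ∀ n, MeasurableSet (A n)), Antitone A → ⋂ n, A n = ∅ →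
      Tendsto (fun n => l (ind P (hA n))) atTop (𝓝 0))
    (f : ℕ → Set Ω) (hf : ∀ n, MeasurableSet (f n)) (hd : Pairwise (Function.onFun Disjoint f)) :
    HasSum (fun n => l (ind P (hf n))) (l (ind P (MeasurableSet.iUnion hf))) := by
  rw [hasSum_iff_tendsto_nat_of_nonneg fun n => hpos _ (ind_nonneg _)]
  let A : ℕ → Set Ω := fun n => ⋃ i, ⋃ _ : n ≤ i, f i
  have hA : ∀ n, MeasurableSet (A n) := fun n =>
    MeasurableSet.iUnion fun i => MeasurableSet.iUnion fun _ => hf i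
  have hanti : Antitone A := by
    intro a b hab ω hω
    simp only [A, Set.mem_iUnion] at hω ⊢
    obtain ⟨i, hi, hω⟩ := hω
    exact ⟨i, hab.trans hi, hω⟩
  have hempty : ⋂ n, A n = ∅ := by
    rw [Set.eq_empty_iff_forall_notMem]
    intro ω hω
    simp only [A, Set.mem_iInter, Set.mem_iUnion] at hω
    obtain ⟨i, -, hi⟩ := hω 0
    obtain ⟨j, hj, hj'⟩ := hω (i + 1)
    exact Set.disjoint_left.1 (hd (by omega : i ≠ j)) hi hj'
  have key : ∀ n, l (ind P (MeasurableSet.iUnion hf)) - l (ind P (hA n)) =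
      ∑ i ∈ Finset.range n, l (ind P (hf i)) := by
    intro n
    induction n with
    | zero =>
      have : (⋃ i, f i) = A 0 := by simp [A]
      simp only [Finset.range_zero, Finset.sum_empty]
      rw [sub_eq_zero]
      congr 2
    | succ n ih =>
      have hu : A n = f n ∪ A (n + 1) := by
        ext ω
        simp only [A, Set.mem_union, Set.mem_iUnion]
        constructor
        · rintro ⟨i, hi, h⟩
          rcases hi.eq_or_lt with rfl | h'
          · exact Or.inl h
          · exact Or.inr ⟨i, h', h⟩
        · rintro (h | ⟨i, hi, h⟩)
          · exact ⟨n, le_rfl, h⟩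
          · exact ⟨i, by omega, h⟩
      have hdisj : Disjoint (f n) (A (n + 1)) := by
        rw [Set.disjoint_left]
        intro ω h1 h2
        simp only [A, Set.mem_iUnion] at h2
        obtain ⟨j, hj, hj'⟩ := h2
        exact Set.disjoint_left.1 (hd (by omega : n ≠ j)) h1 hj'
      have h3 : ind P (hA n) = ind P (hf n) + ind P (hA (n + 1)) := by
        rw [← indicatorConstLp_disjoint_union (hf n) (hA (n + 1)) (measure_ne_top P _)
          (measure_ne_top P _) hdisj]
        congr 1
      rw [Finset.sum_range_succ, ← ih, h3, map_add]
      ring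
  have h := (hcont A hA hanti hempty).const_sub (l (ind P (MeasurableSet.iUnion hf)))
  simp only [key, sub_zero] at h
  exact h

/-- The simple function `⌊n g⌋ / n` attached to a bounded measurable function `g`. -/
theorem exists_simpleFunc_near {g : Ω → ℝ} (hg : Measurable g) {M : ℝ} (hM : ∀ ω, |g ω| ≤ M)
    {n : ℕ} (hn : 0 < n) : ∃ s : SimpleFunc Ω ℝ, ∀ ω, |g ω - s ω| ≤ 1 / n := by
  have hn' : (0 : ℝ) < n := Nat.cast_pos.2 hn
  have hm : Measurable fun ω => (⌊n * g ω⌋ : ℝ) / n :=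
    ((measurable_from_top (f := fun k : ℤ => (k : ℝ))).comp
      (Int.measurable_floor.comp (hg.const_mul (n : ℝ)))).div_const _
  refine ⟨⟨fun ω => (⌊n * g ω⌋ : ℝ) / n, fun x => hm (measurableSet_singleton x), ?_⟩, fun ω => ?_⟩
  · refine ((Set.finite_Icc ⌊n * (-M)⌋ ⌊n * M⌋).image fun k : ℤ => (k : ℝ) / n).subset ?_
    rintro _ ⟨ω, rfl⟩
    refine ⟨⌊n * g ω⌋, ⟨?_, ?_⟩, rfl⟩
    · exact Int.floor_le_floor (mul_le_mul_of_nonneg_left (abs_le.1 (hM ω)).1 hn'.le)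
    · exact Int.floor_le_floor (mul_le_mul_of_nonneg_left (abs_le.1 (hM ω)).2 hn'.le)
  · change |g ω - (⌊n * g ω⌋ : ℝ) / n| ≤ 1 / n
    have h1 := Int.floor_le (n * g ω)
    have h2 := Int.lt_floor_add_one (n * g ω)
    have h3 : g ω - (⌊n * g ω⌋ : ℝ) / n = (n * g ω - ⌊n * g ω⌋) / n := by field_simp
    rw [h3, abs_of_nonneg (div_nonneg (by linarith) hn'.le)]
    gcongr
    linarith

/-- The set function `A ↦ l (1_A)` is countably additive by `hasSum_ind`. The functional and the
integral agree on simple functions and are both bounded by the sup norm, so uniform approximation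
extends the equality to `L^∞`. -/
theorem exists_measure_of_positive (l : Lp ℝ ∞ P →ₗ[ℝ] ℝ) (hpos : ∀ X, 0 ≤ X → 0 ≤ l X)
    (h1 : l (Lp.const ∞ P (1 : ℝ)) = 1)
    (hcont : ∀ (A : ℕ → Set Ω) (hA : ∀ n, MeasurableSet (A n)), Antitone A → ⋂ n, A n = ∅ →
      Tendsto (fun n => l (ind P (hA n))) atTop (𝓝 0)) :
    ∃ Q : Measure Ω, IsProbabilityMeasure Q ∧ Q ≪ P ∧ ∀ X : Lp ℝ ∞ P, l X = ∫ ω, X ω ∂Q := by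
  classical
  have hnn : ∀ {A : Set Ω} (hA : MeasurableSet A), 0 ≤ l (ind P hA) := fun hA =>
    hpos _ (ind_nonneg hA)
  let Q : Measure Ω := Measure.ofMeasurable (fun A hA => ENNReal.ofReal (l (ind P hA)))
    (by simp) (fun f hf hd => by
      have hs := hasSum_ind l hpos hcont f hf hd
      rw [← hs.tsum_eq]
      exact ENNReal.ofReal_tsum_of_nonneg (fun n => hnn (hf n)) hs.summable)
  have hQ : ∀ {A : Set Ω} (hA : MeasurableSet A), Q A = ENNReal.ofReal (l (ind P hA)) := fun hA =>
    Measure.ofMeasurable_apply _ hA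
  have hprob : IsProbabilityMeasure Q := ⟨by
    rw [hQ MeasurableSet.univ, ind, indicatorConstLp_univ, h1, ENNReal.ofReal_one]⟩
  have hac : Q ≪ P := by
    refine Measure.AbsolutelyContinuous.mk fun A hA h0 => ?_
    have : ind P hA = 0 := by
      rw [Lp.eq_zero_iff_ae_eq_zero]
      have hae : ∀ᵐ ω ∂P, ω ∉ A := measure_eq_zero_iff_ae_notMem.1 h0
      filter_upwards [indicatorConstLp_coeFn (p := ∞) (hs := hA) (hμs := measure_ne_top P A)
        (c := (1 : ℝ)), hae] with ω h2 h3
      rw [h2, Set.indicator_of_notMem h3]; rfl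
    rw [hQ hA, this, map_zero, ENNReal.ofReal_zero]
  have hsimple : ∀ (s : SimpleFunc Ω ℝ) (X : Lp ℝ ∞ P), X =ᵐ[P] s → l X = ∫ ω, s ω ∂Q := by
    intro s
    induction s using SimpleFunc.induction with
    | const c hA =>
      rename_i A
      intro X hX
      have hX' : X = c • ind P hA := by
        refine Lp.ext ?_
        filter_upwards [hX, Lp.coeFn_smul c (ind P hA),
          indicatorConstLp_coeFn (p := ∞) (hs := hA) (hμs := measure_ne_top P A)
            (c := (1 : ℝ))] with ω h2 h3 h4
        rw [h2, h3, Pi.smul_apply, h4]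
        by_cases hω : ω ∈ A <;> simp [hω]
      rw [hX', map_smul, SimpleFunc.coe_piecewise, SimpleFunc.coe_const, SimpleFunc.coe_const,
        show Function.const Ω (0 : ℝ) = 0 from rfl, Set.piecewise_eq_indicator]
      rw [show (Function.const Ω c) = fun _ => c from rfl, integral_indicator_const _ hA,
        Measure.real, hQ hA, ENNReal.toReal_ofReal (hnn hA)]
      simp [mul_comm]
    | add hdisj hf hg =>
      rename_i f g
      intro X hX
      let F : Lp ℝ ∞ P := (f.memLp_top P).toLp f
      let G : Lp ℝ ∞ P := (g.memLp_top P).toLp g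
      have hF : F =ᵐ[P] f := MemLp.coeFn_toLp _
      have hG : G =ᵐ[P] g := MemLp.coeFn_toLp _
      have hX' : X = F + G := by
        refine Lp.ext ?_
        filter_upwards [hX, Lp.coeFn_add F G, hF, hG] with ω h2 h3 h4 h5
        rw [h2, h3, Pi.add_apply, h4, h5]; rfl
      rw [hX', map_add, hf F hF, hg G hG, SimpleFunc.coe_add]
      symm
      exact integral_add (SimpleFunc.integrable_of_isFiniteMeasure f)
        (SimpleFunc.integrable_of_isFiniteMeasure g)
  refine ⟨Q, hprob, hac, fun X => ?_⟩
  have hbound : ∀ n : ℕ, |l X - ∫ ω, X ω ∂Q| ≤ 2 / ((n : ℝ) + 1) := by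
    intro n
    -- Clipping gives a version bounded everywhere, as the simple approximation needs a pointwise
    -- bound.
    let g : Ω → ℝ := fun ω => max (-‖X‖) (min (X ω) ‖X‖)
    have hgm : Measurable g :=
      measurable_const.max ((Lp.stronglyMeasurable X).measurable.min measurable_const)
    have hgb : ∀ ω, |g ω| ≤ ‖X‖ := fun ω => abs_le.2
      ⟨le_max_left _ _, max_le (by linarith [norm_nonneg X]) (min_le_right _ _)⟩
    have hXg : ∀ᵐ ω ∂P, X ω = g ω := by
      filter_upwards [ae_abs_le_norm X] with ω h
      have := abs_le.1 h
      simp only [g]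
      rw [min_eq_left this.2, max_eq_right this.1]
    obtain ⟨s, hs⟩ := exists_simpleFunc_near hgm hgb (Nat.succ_pos n)
    push_cast at hs
    let S : Lp ℝ ∞ P := (s.memLp_top P).toLp s
    have hS : S =ᵐ[P] s := MemLp.coeFn_toLp _
    have hnear : ∀ᵐ ω ∂P, |X ω - s ω| ≤ 1 / ((n : ℝ) + 1) := by
      filter_upwards [hXg] with ω h
      rw [h]; exact hs ω
    have hb1 : |l (X - S)| ≤ 1 / ((n : ℝ) + 1) := by
      refine abs_le_of_positive l hpos h1 ?_
      filter_upwards [hnear, hS, Lp.coeFn_sub X S] with ω h2 h3 h4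
      rw [h4, Pi.sub_apply, h3]; exact h2
    have hb2 : |∫ ω, (X ω - s ω) ∂Q| ≤ 1 / ((n : ℝ) + 1) := by
      have hnear' : ∀ᵐ ω ∂Q, ‖X ω - s ω‖ ≤ 1 / ((n : ℝ) + 1) := hac.ae_le hnear
      have := norm_integral_le_of_norm_le_const hnear'
      simpa using this
    rw [integral_sub (integrable_linfty_of_ac hac X) (SimpleFunc.integrable_of_isFiniteMeasure s)]
      at hb2
    rw [map_sub, hsimple s S hS] at hb1
    have h2 : l X - ∫ ω, X ω ∂Q = (l X - ∫ ω, s ω ∂Q) - (∫ ω, X ω ∂Q - ∫ ω, s ω ∂Q) := by ring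
    rw [h2]
    refine (abs_sub _ _).trans ?_
    calc _ ≤ 1 / ((n : ℝ) + 1) + 1 / ((n : ℝ) + 1) := add_le_add hb1 hb2
      _ = _ := by ring
  have hlim : Tendsto (fun n : ℕ => 2 / ((n : ℝ) + 1)) atTop (𝓝 0) := by
    have := (tendsto_one_div_add_atTop_nhds_zero_nat (𝕜 := ℝ)).const_mul 2
    simpa [div_eq_mul_inv] using this
  have h3 : |l X - ∫ ω, X ω ∂Q| ≤ 0 := ge_of_tendsto' hlim hbound
  exact sub_eq_zero.1 (abs_nonpos_iff.1 h3)

end Representation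

/-! ### Selections from decreasing convex sets, and integral functionals. -/

/-- A decreasing sequence of nonempty convex bounded sets in an inner product space has a Cauchy
selection. -/
theorem exists_cauchySeq_of_antitone_convex {H : Type*} [NormedAddCommGroup H]
    [InnerProductSpace ℝ H] (D : ℕ → Set H) (hanti : Antitone D) (hconv : ∀ n, Convex ℝ (D n))
    (hne : ∀ n, (D n).Nonempty) (M : ℝ) (hM : ∀ x ∈ D 0, ‖x‖ ≤ M) :
    ∃ g : ℕ → H, (∀ n, g n ∈ D n) ∧ CauchySeq g := by
  let S : ℕ → Set ℝ := fun n => (fun x => ‖x‖ ^ 2) '' D n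
  let d : ℕ → ℝ := fun n => sInf (S n)
  have hSbdd : ∀ n, BddBelow (S n) := fun n => ⟨0, by rintro _ ⟨x, -, rfl⟩; positivity⟩
  have hSne : ∀ n, (S n).Nonempty := fun n => (hne n).image _
  have hd_le : ∀ n, ∀ x ∈ D n, d n ≤ ‖x‖ ^ 2 := fun n x hx => csInf_le (hSbdd n) ⟨x, hx, rfl⟩
  have hd_mono : Monotone d := fun a b hab =>
    csInf_le_csInf (hSbdd a) (hSne b) (Set.image_mono (hanti hab))
  have hd_bdd : BddAbove (Set.range d) := by
    refine ⟨M ^ 2, ?_⟩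
    rintro _ ⟨n, rfl⟩
    obtain ⟨x, hx⟩ := hne n
    have := hM x (hanti (Nat.zero_le n) hx)
    exact (hd_le n x hx).trans (pow_le_pow_left₀ (norm_nonneg x) this 2)
  have hex : ∀ n : ℕ, ∃ x ∈ D n, ‖x‖ ^ 2 < d n + 1 / ((n : ℝ) + 1) := by
    intro n
    obtain ⟨_, ⟨x, hx, rfl⟩, h⟩ := Real.lt_sInf_add_pos (hSne n)
      (show (0 : ℝ) < 1 / ((n : ℝ) + 1) by positivity)
    exact ⟨x, hx, h⟩
  choose g hg hgd using hex
  refine ⟨g, hg, ?_⟩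
  let s := ⨆ n, d n
  have hds : Tendsto d atTop (𝓝 s) := tendsto_atTop_ciSup hd_mono hd_bdd
  have hlim : Tendsto (fun N : ℕ => 4 * (s - d N) + 4 * (1 / ((N : ℝ) + 1))) atTop (𝓝 0) := by
    have := ((hds.const_sub s).const_mul 4).add
      ((tendsto_one_div_add_atTop_nhds_zero_nat (𝕜 := ℝ)).const_mul 4)
    simpa using this
  have hlim' := hlim.sqrt
  rw [Real.sqrt_zero] at hlim'
  refine cauchySeq_of_le_tendsto_0 _ (fun n k N hn hk => ?_) hlim'
  rw [dist_eq_norm]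
  refine Real.le_sqrt_of_sq_le ?_
  have hbound : ∀ j, N ≤ j → ‖g j‖ ^ 2 ≤ s + 1 / ((N : ℝ) + 1) := by
    intro j hj
    have h1 : d j ≤ s := le_ciSup hd_bdd j
    have h2 : 1 / ((j : ℝ) + 1) ≤ 1 / ((N : ℝ) + 1) := by gcongr
    linarith [hgd j]
  -- The midpoint of `g n` and `g k` stays in `D N`, so its squared norm is at least `d N`; the
  -- parallelogram law then gives `‖g n - g k‖² ≤ 4 (s - d N) + 4 / (N + 1)`.
  have hmid : d N ≤ ‖(1 / 2 : ℝ) • g n + (1 / 2 : ℝ) • g k‖ ^ 2 :=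
    hd_le N _ (hconv N (hanti hn (hg n)) (hanti hk (hg k)) (by norm_num) (by norm_num)
      (by norm_num))
  rw [← smul_add, norm_smul, mul_pow] at hmid
  norm_num at hmid
  have hpar := parallelogram_law_with_norm ℝ (g n) (g k)
  linarith [hbound n hn, hbound k hk]

section Functionals

variable {Ω : Type*} {m : MeasurableSpace Ω} {P : Measure Ω}

theorem exists_linfty_of_ae_bound {f : Ω → ℝ} (hf : AEStronglyMeasurable f P) {M : ℝ}
    (hM : ∀ᵐ ω ∂P, |f ω| ≤ M) : ∃ X : Lp ℝ ∞ P, X =ᵐ[P] f :=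
  ⟨(memLp_top_of_bound hf M hM).toLp f, MemLp.coeFn_toLp _⟩

variable [IsFiniteMeasure P]

/-- A decreasing sequence of nonempty convex sets, bounded in `L^∞`, has a selection converging
almost everywhere. -/
theorem exists_tendsto_ae_of_antitone_convex (D : ℕ → Set (Lp ℝ ∞ P)) (hanti : Antitone D)
    (hconv : ∀ n, Convex ℝ (D n)) (hne : ∀ n, (D n).Nonempty) (M : ℝ)
    (hM : ∀ X ∈ D 0, ∀ᵐ ω ∂P, |X ω| ≤ M) :
    ∃ (g : ℕ → Lp ℝ ∞ P) (X : Lp ℝ ∞ P), (∀ n, g n ∈ D n) ∧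
      ∀ᵐ ω ∂P, Tendsto (fun n => g n ω) atTop (𝓝 (X ω)) := by
  -- The same sets read in the Hilbert space `L²`. An a.e. convergent subsequence is still a
  -- selection, because `ns n ≥ n` and `D` decreases.
  let D' : ℕ → Set (Lp ℝ 2 P) := fun n => {f | ∃ X ∈ D n, f =ᵐ[P] X}
  have hanti' : Antitone D' := by
    rintro a b hab f ⟨X, hX, hf⟩
    exact ⟨X, hanti hab hX, hf⟩
  have hconv' : ∀ n, Convex ℝ (D' n) := by
    rintro n f ⟨X, hX, hf⟩ g ⟨Y, hY, hg⟩ a b ha hb hab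
    refine ⟨a • X + b • Y, hconv n hX hY ha hb hab, ?_⟩
    filter_upwards [hf, hg, Lp.coeFn_add (a • f) (b • g), Lp.coeFn_smul a f, Lp.coeFn_smul b g,
      Lp.coeFn_add (a • X) (b • Y), Lp.coeFn_smul a X, Lp.coeFn_smul b Y]
      with ω h1 h2 h3 h4 h5 h6 h7 h8
    simp only [h3, h6, Pi.add_apply, h4, h5, h7, h8, Pi.smul_apply, h1, h2]
  have hne' : ∀ n, (D' n).Nonempty := by
    intro n
    obtain ⟨X, hX⟩ := hne n
    have hX2 : MemLp X 2 P := (Lp.memLp X).mono_exponent le_top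
    exact ⟨hX2.toLp X, X, hX, hX2.coeFn_toLp⟩
  have hM' : ∀ f ∈ D' 0, ‖f‖ ≤ P.real Set.univ ^ (ENNReal.toReal 2)⁻¹ * max M 0 := by
    rintro f ⟨X, hX, hf⟩
    refine Lp.norm_le_of_ae_bound (le_max_right _ _) ?_
    filter_upwards [hf, hM X hX] with ω h1 h2
    rw [h1]
    exact h2.trans (le_max_left _ _)
  obtain ⟨g, hg, hc⟩ := exists_cauchySeq_of_antitone_convex D' hanti' hconv' hne' _ hM'
  obtain ⟨f, hf⟩ := cauchySeq_tendsto_of_complete hc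
  obtain ⟨ns, hns, hae⟩ := (tendstoInMeasure_of_tendsto_Lp hf).exists_seq_tendsto_ae
  choose G hGD hG using hg
  have hall : ∀ᵐ ω ∂P, ∀ n, g n ω = G n ω := ae_all_iff.2 hG
  have hbd : ∀ᵐ ω ∂P, ∀ n, |G n ω| ≤ M :=
    ae_all_iff.2 fun n => hM _ (hanti (Nat.zero_le n) (hGD n))
  have hfb : ∀ᵐ ω ∂P, |f ω| ≤ M := by
    filter_upwards [hae, hall, hbd] with ω h1 h2 h3
    refine le_of_tendsto' h1.abs fun i => ?_
    rw [h2]; exact h3 _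
  obtain ⟨X, hX⟩ := exists_linfty_of_ae_bound (Lp.aestronglyMeasurable f) hfb
  refine ⟨fun n => G (ns n), X, fun n => hanti (hns.id_le n) (hGD (ns n)), ?_⟩
  filter_upwards [hae, hall, hX] with ω h1 h2 h3
  simp only [h2] at h1
  rwa [h3]

theorem exists_bound_comp {f : ℝ → ℝ} (hf : Continuous f) (M : ℝ) :
    ∃ C, ∀ x, |x| ≤ M → |f x| ≤ C := by
  obtain ⟨C, hC⟩ := (isCompact_Icc (a := -M) (b := M)).exists_bound_of_continuousOn hf.continuousOn
  exact ⟨C, fun x hx => hC x (abs_le.1 hx)⟩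

theorem integrable_comp_linfty {f : ℝ → ℝ} (hf : Continuous f) (X : Lp ℝ ∞ P) :
    Integrable (fun ω => f (X ω)) P := by
  obtain ⟨C, hC⟩ := exists_bound_comp hf ‖X‖
  exact Integrable.of_bound (hf.comp_aestronglyMeasurable (Lp.aestronglyMeasurable X)) C
    ((ae_abs_le_norm X).mono fun ω h => hC _ h)

theorem tendsto_integral_comp_linfty {f : ℝ → ℝ} (hf : Continuous f) {Xn : ℕ → Lp ℝ ∞ P}
    {X : Lp ℝ ∞ P} {M : ℝ} (hM : ∀ n, ∀ᵐ ω ∂P, |Xn n ω| ≤ M)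
    (hX : ∀ᵐ ω ∂P, Tendsto (fun n => Xn n ω) atTop (𝓝 (X ω))) :
    Tendsto (fun n => ∫ ω, f (Xn n ω) ∂P) atTop (𝓝 (∫ ω, f (X ω) ∂P)) := by
  obtain ⟨C, hC⟩ := exists_bound_comp hf M
  refine tendsto_integral_of_dominated_convergence (fun _ => C)
    (fun n => hf.comp_aestronglyMeasurable (Lp.aestronglyMeasurable (Xn n)))
    (integrable_const C) (fun n => (hM n).mono fun ω h => hC _ h) ?_
  filter_upwards [hX] with ω h
  exact (hf.tendsto _).comp h

theorem integral_comp_convex {f : ℝ → ℝ} (hf : Continuous f) (hc : ConvexOn ℝ Set.univ f)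
    (X Y : Lp ℝ ∞ P) {a b : ℝ} (ha : 0 ≤ a) (hb : 0 ≤ b) (hab : a + b = 1) :
    ∫ ω, f ((a • X + b • Y : Lp ℝ ∞ P) ω) ∂P ≤ a * ∫ ω, f (X ω) ∂P + b * ∫ ω, f (Y ω) ∂P := by
  rw [← integral_const_mul, ← integral_const_mul, ← integral_add
    ((integrable_comp_linfty hf X).const_mul a) ((integrable_comp_linfty hf Y).const_mul b)]
  refine integral_mono_ae (integrable_comp_linfty hf _)
    (((integrable_comp_linfty hf X).const_mul a).add ((integrable_comp_linfty hf Y).const_mul b)) ?_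
  filter_upwards [Lp.coeFn_add (a • X) (b • Y), Lp.coeFn_smul a X, Lp.coeFn_smul b Y]
    with ω h1 h2 h3
  simp only [h1, h2, h3, Pi.add_apply, Pi.smul_apply]
  exact hc.2 (Set.mem_univ _) (Set.mem_univ _) ha hb hab

/-! ### Scalar price functionals, and the case of continuity from above. -/

/-- Normalized, monotone, cash-invariant, convex functionals on `L^∞`. -/
structure IsPriceFunctional (p : Lp ℝ ∞ P → ℝ) : Prop where
  mono : ∀ X Y, X ≤ Y → p X ≤ p Y
  cash : ∀ X (c : ℝ), p (X + c • Lp.const ∞ P (1 : ℝ)) = p X + c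
  convex : ConvexOn ℝ Set.univ p
  zero : p 0 = 0

/-- Continuity from below for functionals on `L^∞`. -/
def ContinuousBelow (p : Lp ℝ ∞ P → ℝ) : Prop :=
  ∀ (Xn : ℕ → Lp ℝ ∞ P) (X : Lp ℝ ∞ P), Monotone Xn →
    (∀ᵐ ω ∂P, Tendsto (fun n => Xn n ω) atTop (𝓝 (X ω))) →
    Tendsto (fun n => p (Xn n)) atTop (𝓝 (p X))

/-- Continuity from above for functionals on `L^∞`. -/
def ContinuousAbove (p : Lp ℝ ∞ P → ℝ) : Prop :=
  ∀ (Xn : ℕ → Lp ℝ ∞ P) (X : Lp ℝ ∞ P), Antitone Xn →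
    (∀ᵐ ω ∂P, Tendsto (fun n => Xn n ω) atTop (𝓝 (X ω))) →
    Tendsto (fun n => p (Xn n)) atTop (𝓝 (p X))

namespace IsPriceFunctional

variable {p : Lp ℝ ∞ P → ℝ}

theorem smul_one (hp : IsPriceFunctional p) (c : ℝ) : p (c • Lp.const ∞ P (1 : ℝ)) = c := by
  have := hp.cash 0 c
  rwa [zero_add, hp.zero, zero_add] at this

theorem le_add_norm (hp : IsPriceFunctional p) (X Y : Lp ℝ ∞ P) : p X ≤ p Y + ‖X - Y‖ := by
  rw [← hp.cash]
  refine hp.mono _ _ ?_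
  rw [← sub_le_iff_le_add']
  exact le_smul_one ((ae_abs_le_norm (X - Y)).mono fun ω h => (abs_le.1 h).2)

theorem continuous (hp : IsPriceFunctional p) : Continuous p := by
  refine LipschitzWith.continuous (K := 1) (LipschitzWith.of_le_add fun X Y => ?_)
  rw [dist_eq_norm]
  exact hp.le_add_norm X Y

theorem isOpen_neg (hp : IsPriceFunctional p) : IsOpen {X | p X < 0} :=
  isOpen_lt hp.continuous continuous_const

theorem convex_neg (hp : IsPriceFunctional p) : Convex ℝ {X | p X < 0} := by
  have := hp.convex.convex_lt 0
  simpa using this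

theorem tendsto_ind (hp : IsPriceFunctional p) (hc : ContinuousAbove p) (A : ℕ → Set Ω)
    (hA : ∀ n, MeasurableSet (A n)) (hanti : Antitone A) (hempty : ⋂ n, A n = ∅) :
    Tendsto (fun n => p (ind P (hA n))) atTop (𝓝 0) := by
  have hall : ∀ᵐ ω ∂P, ∀ n, ind P (hA n) ω = (A n).indicator (fun _ => (1 : ℝ)) ω :=
    ae_all_iff.2 fun n => indicatorConstLp_coeFn
  rw [← hp.zero]
  refine hc _ _ (fun a b hab => ?_) ?_
  · rw [← Lp.coeFn_le]
    filter_upwards [hall] with ω h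
    rw [h, h]
    exact Set.indicator_le_indicator_of_subset (hanti hab) (fun _ => zero_le_one) ω
  · filter_upwards [hall, Lp.coeFn_zero ℝ ∞ P] with ω h h0
    rw [h0]
    have hω : ω ∉ ⋂ n, A n := by simp [hempty]
    rw [Set.mem_iInter] at hω
    push Not at hω
    obtain ⟨N, hN⟩ := hω
    refine tendsto_const_nhds.congr' ?_
    filter_upwards [eventually_ge_atTop N] with n hn
    rw [h, Set.indicator_of_notMem fun h' => hN (hanti hn h')]; rfl

/-- A linear functional that is nonpositive on `{p < 0}` is dominated by `p`, up to a factor. -/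
theorem le_mul_of_nonpos (hp : IsPriceFunctional p) (l : Lp ℝ ∞ P →ₗ[ℝ] ℝ)
    (hl : ∀ X, p X < 0 → l X ≤ 0) (X : Lp ℝ ∞ P) :
    l X ≤ p X * l (Lp.const ∞ P (1 : ℝ)) := by
  refine le_of_forall_pos_le_add fun e he => ?_
  set u := l (Lp.const ∞ P (1 : ℝ)) with hu
  have hupos : 0 ≤ u := by
    have := hl ((-1 : ℝ) • Lp.const ∞ P (1 : ℝ)) (by rw [hp.smul_one]; norm_num)
    rw [map_smul, smul_eq_mul] at this
    linarith
  -- Shifting `X` by `-(p X) - d` gives price `-d < 0`; the `+ 1` covers `u = 0` while keeping `d *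
  -- u ≤ e`.
  let d := e / (u + 1)
  have hd : 0 < d := by positivity
  have h := hl (X + (-(p X) - d) • Lp.const ∞ P (1 : ℝ)) (by rw [hp.cash]; linarith)
  rw [map_add, map_smul, smul_eq_mul, ← hu] at h
  have : d * u ≤ e := by
    rw [div_mul_eq_mul_div, div_le_iff₀ (by linarith)]
    nlinarith
  linarith

theorem nonneg_of_le_mul (hp : IsPriceFunctional p) (l : Lp ℝ ∞ P →ₗ[ℝ] ℝ) {u : ℝ} (hu : 0 ≤ u)
    (hl : ∀ X, l X ≤ p X * u) {X : Lp ℝ ∞ P} (hX : 0 ≤ X) : 0 ≤ l X := by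
  have h1 := hl (-X)
  have h2 : p (-X) ≤ 0 := by
    rw [← hp.zero]; exact hp.mono _ _ (neg_nonpos.2 hX)
  rw [map_neg] at h1
  nlinarith

/-- Representation by a probability measure of a linear functional which is dominated by `p` and
continuous at the empty set. -/
theorem exists_measure (hp : IsPriceFunctional p) (l : Lp ℝ ∞ P →ₗ[ℝ] ℝ)
    (hu : 0 < l (Lp.const ∞ P (1 : ℝ))) (hl : ∀ X, l X ≤ p X * l (Lp.const ∞ P (1 : ℝ)))
    (hcont : ∀ (A : ℕ → Set Ω) (hA : ∀ n, MeasurableSet (A n)), Antitone A → ⋂ n, A n = ∅ →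
      Tendsto (fun n => l (ind P (hA n))) atTop (𝓝 0)) :
    ∃ Q : Measure Ω, IsProbabilityMeasure Q ∧ Q ≪ P ∧ (∀ X : Lp ℝ ∞ P, ∫ ω, X ω ∂Q ≤ p X) ∧
      ∀ X : Lp ℝ ∞ P, ∫ ω, X ω ∂Q = l X / l (Lp.const ∞ P (1 : ℝ)) := by
  set u := l (Lp.const ∞ P (1 : ℝ)) with hudef
  obtain ⟨Q, hQ, hac, hrep⟩ := exists_measure_of_positive (u⁻¹ • l)
    (fun X hX => mul_nonneg (inv_nonneg.2 hu.le) (hp.nonneg_of_le_mul l hu.le hl hX))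
    (by simp [← hudef, hu.ne'])
    (fun A hA h1 h2 => by simpa using (hcont A hA h1 h2).const_mul u⁻¹)
  have hrep' : ∀ X : Lp ℝ ∞ P, ∫ ω, X ω ∂Q = l X / u := fun X => by
    rw [← hrep, LinearMap.smul_apply, smul_eq_mul]; ring
  refine ⟨Q, hQ, hac, fun X => ?_, hrep'⟩
  rw [hrep', div_le_iff₀ hu]
  exact hl X

/-- Hahn–Banach separates `0` from the open convex set `{p < 0}`. The functional is dominated by a
multiple of `p`, so continuity from above of `p` makes it continuous at `∅`. -/
theorem exists_measure_of_continuousAbove (hp : IsPriceFunctional p) (hc : ContinuousAbove p) :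
    ∃ Q : Measure Ω, IsProbabilityMeasure Q ∧ Q ≪ P ∧ ∀ X : Lp ℝ ∞ P, ∫ ω, X ω ∂Q ≤ p X := by
  obtain ⟨f, hf⟩ := geometric_hahn_banach_open_point hp.convex_neg hp.isOpen_neg
    (x := 0) (by simp [hp.zero])
  rw [map_zero] at hf
  let l : Lp ℝ ∞ P →ₗ[ℝ] ℝ := f.toLinearMap
  have hu : 0 < l (Lp.const ∞ P (1 : ℝ)) := by
    have : l ((-1 : ℝ) • Lp.const ∞ P (1 : ℝ)) < 0 :=
      hf _ (show p _ < 0 by rw [hp.smul_one]; norm_num)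
    rw [map_smul, smul_eq_mul] at this
    linarith
  have hl := hp.le_mul_of_nonpos l fun X hX => (hf X hX).le
  obtain ⟨Q, h1, h2, h3, -⟩ := hp.exists_measure l hu hl fun A hA ha he => by
    refine squeeze_zero (fun n => hp.nonneg_of_le_mul l hu.le hl (ind_nonneg _))
      (fun n => hl _) ?_
    simpa using (hp.tendsto_ind hc A hA ha he).mul_const (l (Lp.const ∞ P (1 : ℝ)))
  exact ⟨Q, h1, h2, h3⟩

end IsPriceFunctional

end Functionals

/-! ### Sublinear functionals continuous from below: separation by a Young function. -/

section Sublinear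

variable {Ω : Type*} {m : MeasurableSpace Ω} {P : Measure Ω} [IsFiniteMeasure P]
  {p : Lp ℝ ∞ P → ℝ}

/-- The Fatou property: the acceptance set of a functional which is continuous from below is closed
under bounded almost everywhere convergence. -/
theorem IsPriceFunctional.nonpos_of_tendsto_ae (hp : IsPriceFunctional p) (hc : ContinuousBelow p)
    {Xn : ℕ → Lp ℝ ∞ P} {X : Lp ℝ ∞ P} {M : ℝ} (hM : ∀ n, ∀ᵐ ω ∂P, |Xn n ω| ≤ M)
    (hX : ∀ᵐ ω ∂P, Tendsto (fun n => Xn n ω) atTop (𝓝 (X ω))) (hneg : ∀ n, p (Xn n) ≤ 0) :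
    p X ≤ 0 := by
  have hMall : ∀ᵐ ω ∂P, ∀ n, |Xn n ω| ≤ M := ae_all_iff.2 hM
  -- Tail infima increase to `X` and lie below `Xn n`, so they are acceptable and continuity from
  -- below applies.
  let y : ℕ → Ω → ℝ := fun n ω => ⨅ k, Xn (n + k) ω
  have hym : ∀ n, AEStronglyMeasurable (y n) P := fun n =>
    (Measurable.iInf fun k => (Lp.stronglyMeasurable (Xn (n + k))).measurable).aestronglyMeasurable
  have hbdd : ∀ ω, (∀ n, |Xn n ω| ≤ M) → ∀ n, BddBelow (Set.range fun k => Xn (n + k) ω) := by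
    intro ω h n
    refine ⟨-M, ?_⟩
    rintro _ ⟨k, rfl⟩
    exact (abs_le.1 (h _)).1
  have hyb : ∀ n, ∀ᵐ ω ∂P, |y n ω| ≤ M := by
    intro n
    filter_upwards [hMall] with ω h
    exact abs_le.2 ⟨le_ciInf fun k => (abs_le.1 (h _)).1,
      (ciInf_le (hbdd ω h n) 0).trans (abs_le.1 (h _)).2⟩
  choose Y hY using fun n => exists_linfty_of_ae_bound (hym n) (hyb n)
  have hYall : ∀ᵐ ω ∂P, ∀ n, Y n ω = y n ω := ae_all_iff.2 hY
  have hmono : Monotone Y := by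
    intro a b hab
    rw [← Lp.coeFn_le]
    filter_upwards [hMall, hYall] with ω h1 h2
    rw [h2, h2]
    refine le_ciInf fun k => ?_
    have := ciInf_le (hbdd ω h1 a) (b - a + k)
    rwa [show a + (b - a + k) = b + k by omega] at this
  have hlim : ∀ᵐ ω ∂P, Tendsto (fun n => Y n ω) atTop (𝓝 (X ω)) := by
    filter_upwards [hMall, hYall, hX] with ω h1 h2 h3
    simp only [h2]
    rw [Metric.tendsto_atTop] at h3 ⊢
    intro e he
    obtain ⟨N, hN⟩ := h3 (e / 2) (half_pos he)
    refine ⟨N, fun n hn => ?_⟩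
    have hle : y n ω ≤ Xn n ω := ciInf_le (hbdd ω h1 n) 0
    have hge : X ω - e / 2 ≤ y n ω := le_ciInf fun k => by
      have := hN (n + k) (by omega)
      rw [Real.dist_eq, abs_lt] at this
      linarith
    have := hN n hn
    rw [Real.dist_eq, abs_lt] at this ⊢
    constructor <;> linarith
  refine le_of_tendsto' (hc Y X hmono hlim) fun n => (hp.mono _ _ ?_).trans (hneg n)
  rw [← Lp.coeFn_le]
  filter_upwards [hMall, hYall] with ω h1 h2
  rw [h2]
  exact ciInf_le (hbdd ω h1 n) 0

theorem continuous_const_mul_posPart_sub (c a : ℝ) :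
    Continuous fun t : ℝ => c * max (t - a) 0 := by fun_prop

theorem convexOn_const_mul_posPart_sub {c : ℝ} (hc : 0 ≤ c) (a : ℝ) :
    ConvexOn ℝ Set.univ fun t : ℝ => c * max (t - a) 0 := by
  have h1 : ConvexOn ℝ Set.univ fun t : ℝ => t - a :=
    (convexOn_id convex_univ).sub (concaveOn_const a convex_univ)
  exact (h1.sup (convexOn_const 0 convex_univ)).smul hc

/-- Property of a Young function `f` at level `n`: the modular `E f(h)` exceeds `1` for each
nonnegative `h ≤ n` for which `x₀ - h` is acceptable. -/
def Detects (p : Lp ℝ ∞ P → ℝ) (x₀ : Lp ℝ ∞ P) (n : ℕ) (f : ℝ → ℝ) : Prop :=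
  ∀ h : Lp ℝ ∞ P, 0 ≤ h → (∀ᵐ ω ∂P, h ω ≤ n) → p (x₀ - h) ≤ 0 → 1 < ∫ ω, f (h ω) ∂P

/-- If every slope `c = k` failed, the convex sets of counterexamples would decrease in `k`, and a
selection would converge a.e. to some `X`. By the Fatou property `x₀ - X` is acceptable; the growing
slopes force `X ≤ n`, yet `E f(X) ≤ 1`, against detection at level `n`. -/
theorem Detects.exists_succ (hp : IsPriceFunctional p) (hc : ContinuousBelow p) {x₀ : Lp ℝ ∞ P}
    {n : ℕ} {f : ℝ → ℝ} (hf : Continuous f) (hconv : ConvexOn ℝ Set.univ f)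
    (hd : Detects p x₀ n f) :
    ∃ c : ℝ, 0 ≤ c ∧ Detects p x₀ (n + 1) fun t => f t + c * max (t - n) 0 := by
  by_contra! hno
  have hG : ∀ c : ℝ, Continuous fun t => f t + c * max (t - n) 0 := fun c =>
    hf.add (continuous_const_mul_posPart_sub c n)
  have hφ : Continuous fun t : ℝ => max (t - n) 0 := by fun_prop
  have hsplit : ∀ (c : ℝ) (h : Lp ℝ ∞ P), ∫ ω, (f (h ω) + c * max (h ω - n) 0) ∂P =
      ∫ ω, f (h ω) ∂P + c * ∫ ω, max (h ω - n) 0 ∂P := fun c h => by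
    rw [integral_add (integrable_comp_linfty hf h)
      ((integrable_comp_linfty hφ h).const_mul c), integral_const_mul]
  have hφnn : ∀ h : Lp ℝ ∞ P, 0 ≤ ∫ ω, max (h ω - n) 0 ∂P := fun h =>
    integral_nonneg fun ω => le_max_right _ _
  let D : ℕ → Set (Lp ℝ ∞ P) := fun k => {h | 0 ≤ h ∧ (∀ᵐ ω ∂P, h ω ≤ n + 1) ∧
    p (x₀ - h) ≤ 0 ∧ ∫ ω, (f (h ω) + k * max (h ω - n) 0) ∂P ≤ 1}
  have hDanti : Antitone D := by
    rintro a b hab h ⟨h1, h2, h3, h4⟩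
    refine ⟨h1, h2, h3, le_trans ?_ h4⟩
    rw [hsplit, hsplit]
    have : (a : ℝ) ≤ b := Nat.cast_le.2 hab
    gcongr
  have hDconv : ∀ k, Convex ℝ (D k) := by
    rintro k h ⟨h1, h2, h3, h4⟩ g ⟨g1, g2, g3, g4⟩ a b ha hb hab
    refine ⟨add_nonneg (smul_nonneg_linfty ha h1) (smul_nonneg_linfty hb g1), ?_, ?_, ?_⟩
    · filter_upwards [h2, g2, Lp.coeFn_add (a • h) (b • g), Lp.coeFn_smul a h, Lp.coeFn_smul b g]
        with ω e1 e2 e3 e4 e5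
      simp only [e3, Pi.add_apply, e4, e5, Pi.smul_apply, smul_eq_mul]
      nlinarith
    · have e : x₀ - (a • h + b • g) = a • (x₀ - h) + b • (x₀ - g) := by
        rw [smul_sub, smul_sub, sub_add_sub_comm, ← add_smul, hab, one_smul]
      rw [e]
      have := hp.convex.2 (Set.mem_univ (x₀ - h)) (Set.mem_univ (x₀ - g)) ha hb hab
      simp only [smul_eq_mul] at this
      nlinarith
    · refine (integral_comp_convex (hG k)
        (hconv.add (convexOn_const_mul_posPart_sub k.cast_nonneg n)) h g ha hb hab).trans ?_
      nlinarith
  have hDne : ∀ k, (D k).Nonempty := by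
    intro k
    have := hno k k.cast_nonneg
    rw [Detects] at this
    push Not at this
    obtain ⟨h, h1, h2, h3, h4⟩ := this
    exact ⟨h, h1, by simpa using h2, h3, h4⟩
  have hDb : ∀ k, ∀ h ∈ D k, ∀ᵐ ω ∂P, |h ω| ≤ n + 1 := by
    rintro k h ⟨h1, h2, -, -⟩
    filter_upwards [h2, Lp.coeFn_nonneg h |>.2 h1] with ω e1 e2
    exact abs_le.2 ⟨by linarith [show (0 : ℝ) ≤ h ω from e2, n.cast_nonneg (α := ℝ)], e1⟩
  obtain ⟨g, X, hgD, hgX⟩ := exists_tendsto_ae_of_antitone_convex D hDanti hDconv hDne _ (hDb 0)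
  have hgb : ∀ k, ∀ᵐ ω ∂P, |g k ω| ≤ n + 1 := fun k => hDb k _ (hgD k)
  have hX0 : 0 ≤ X := by
    rw [← Lp.coeFn_nonneg]
    have : ∀ᵐ ω ∂P, ∀ k, 0 ≤ g k ω := ae_all_iff.2 fun k => (Lp.coeFn_nonneg (g k)).2 (hgD k).1
    filter_upwards [this, hgX] with ω e1 e2
    exact ge_of_tendsto' e2 e1
  have hXp : p (x₀ - X) ≤ 0 := by
    refine hp.nonpos_of_tendsto_ae hc (Xn := fun k => x₀ - g k) (M := ‖x₀‖ + (n + 1)) ?_ ?_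
      fun k => (hgD k).2.2.1
    · intro k
      filter_upwards [hgb k, ae_abs_le_norm x₀, Lp.coeFn_sub x₀ (g k)] with ω e1 e2 e3
      rw [e3, Pi.sub_apply]
      exact (abs_sub _ _).trans (add_le_add e2 e1)
    · have : ∀ᵐ ω ∂P, ∀ k, (x₀ - g k : Lp ℝ ∞ P) ω = x₀ ω - g k ω :=
        ae_all_iff.2 fun k => Lp.coeFn_sub x₀ (g k)
      filter_upwards [this, hgX, Lp.coeFn_sub x₀ X] with ω e1 e2 e3
      simp only [e1, e3, Pi.sub_apply]
      exact e2.const_sub _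
  have hXint : ∀ k : ℕ, ∫ ω, f (X ω) ∂P + k * ∫ ω, max (X ω - n) 0 ∂P ≤ 1 := by
    intro k
    rw [← hsplit]
    refine le_of_tendsto (tendsto_integral_comp_linfty (hG k) hgb hgX) ?_
    filter_upwards [eventually_ge_atTop k] with j hj
    exact (hDanti hj (hgD j)).2.2.2
  have hzero : ∫ ω, max (X ω - n) 0 ∂P = 0 := by
    by_contra hne
    have hpos := lt_of_le_of_ne (hφnn X) (Ne.symm hne)
    obtain ⟨k, hk⟩ := exists_nat_gt ((1 - ∫ ω, f (X ω) ∂P) / ∫ ω, max (X ω - n) 0 ∂P)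
    rw [div_lt_iff₀ hpos] at hk
    linarith [hXint k]
  have hXn : ∀ᵐ ω ∂P, X ω ≤ n := by
    have := (integral_eq_zero_iff_of_nonneg (fun ω => le_max_right _ _)
      (integrable_comp_linfty hφ X)).1 hzero
    filter_upwards [this] with ω e
    have := (le_max_left (X ω - n) 0).trans_eq e
    simpa using this
  have h1 := hd X hX0 hXn hXp
  have h2 := hXint 0
  rw [hzero] at h2
  linarith

/-- The successive Young functions attached to `x₀`. -/
theorem exists_youngSeq (hp : IsPriceFunctional p) (hc : ContinuousBelow p) {x₀ : Lp ℝ ∞ P}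
    (hx₀ : 0 < p x₀) :
    ∃ F : ℕ → ℝ → ℝ, (∀ n, Continuous (F n)) ∧ (∀ n, ConvexOn ℝ Set.univ (F n)) ∧
      (∀ n, Detects p x₀ n (F n)) ∧ (∀ t, F 0 t = 0) ∧
      ∀ n, ∃ c : ℝ, 0 ≤ c ∧ ∀ t, F (n + 1) t = F n t + c * max (t - n) 0 := by
  -- At level `0` the only candidate is `h = 0`, and `x₀` itself is not acceptable.
  have h0 : Detects p x₀ 0 fun _ => 0 := by
    intro h h1 h2 h3
    have : h = 0 := by
      refine le_antisymm ?_ h1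
      rw [← Lp.coeFn_le]
      filter_upwards [h2, Lp.coeFn_zero ℝ ∞ P] with ω e1 e2
      rw [e2]; simpa using e1
    rw [this, sub_zero] at h3
    exact absurd h3 (not_le.2 hx₀)
  let T : ℕ → Type := fun n =>
    {f : ℝ → ℝ // Continuous f ∧ ConvexOn ℝ Set.univ f ∧ Detects p x₀ n f}
  have hstep : ∀ n (f : T n), ∃ g : T (n + 1), ∃ c : ℝ, 0 ≤ c ∧
      ∀ t, g.1 t = f.1 t + c * max (t - n) 0 := by
    rintro n ⟨f, hf1, hf2, hf3⟩
    obtain ⟨c, hc0, hcd⟩ := hf3.exists_succ hp hc hf1 hf2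
    exact ⟨⟨_, hf1.add (continuous_const_mul_posPart_sub c n),
      hf2.add (convexOn_const_mul_posPart_sub hc0 n), hcd⟩, c, hc0, fun t => rfl⟩
  choose next hnext using hstep
  let F : ∀ n, T n := fun n => Nat.rec (motive := T)
    ⟨fun _ => 0, continuous_const, convexOn_const 0 convex_univ, h0⟩ next n
  exact ⟨fun n => (F n).1, fun n => (F n).2.1, fun n => (F n).2.2.1, fun n => (F n).2.2.2,
    fun t => rfl, fun n => hnext n (F n)⟩

/-- A sublinear functional which is continuous from below dominates, for each event `A` with positive
price, a probability measure charging `A`. -/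
theorem IsPriceFunctional.exists_measure_pos (hp : IsPriceFunctional p) (hc : ContinuousBelow p)
    (hom : ∀ (t : ℝ) (X : Lp ℝ ∞ P), 0 < t → p (t • X) = t * p X) {A : Set Ω}
    (hA : MeasurableSet A) (hpA : 0 < p (ind P hA)) :
    ∃ Q : Measure Ω, IsProbabilityMeasure Q ∧ Q ≪ P ∧ (∀ X : Lp ℝ ∞ P, ∫ ω, X ω ∂Q ≤ p X) ∧
      0 < ∫ ω, ind P hA ω ∂Q := by
  set one : Lp ℝ ∞ P := Lp.const ∞ P (1 : ℝ) with hone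
  set e := p (ind P hA) / 2 with he
  have hepos : 0 < e := half_pos hpA
  -- Removing half the price of `1_A` keeps `p x₀ = e > 0`, and the cash taken out later makes `l
  -- (1_A)` strictly positive.
  let x₀ : Lp ℝ ∞ P := ind P hA + (-e) • one
  have hpx₀ : p x₀ = e := by rw [hp.cash]; linarith
  obtain ⟨F, hFc, hFconv, hFd, hF0, hFs⟩ := exists_youngSeq hp hc (hpx₀ ▸ hepos : 0 < p x₀)
  have hFmono : ∀ t, Monotone fun n => F n t := fun t => monotone_nat_of_le_succ fun n => by
    obtain ⟨c, hc0, hcF⟩ := hFs n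
    rw [hcF]
    have : 0 ≤ c * max (t - n) 0 := mul_nonneg hc0 (le_max_right _ _)
    linarith
  -- The correction added at level `n` vanishes on `t ≤ n`, so the sequence is stationary on each
  -- half-line and its supremum is a finite Young function.
  have hFeq : ∀ (N : ℕ) (t : ℝ), t ≤ N → ∀ k, F (N + k) t = F N t := by
    intro N t ht k
    induction k with
    | zero => rfl
    | succ k ih =>
      obtain ⟨c, -, hcF⟩ := hFs (N + k)
      have : t - ((N + k : ℕ) : ℝ) ≤ 0 := by push_cast; linarith [k.cast_nonneg (α := ℝ)]
      rw [← add_assoc, hcF, max_eq_right this, mul_zero, add_zero, ih]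
  have hFnonpos : ∀ n t, t ≤ 0 → F n t = 0 := fun n t ht => by
    have := hFeq 0 t (by simpa using ht) n
    rwa [zero_add, hF0] at this
  have hFle : ∀ (N : ℕ) (t : ℝ), t ≤ N → ∀ n, F n t ≤ F N t := fun N t ht n => by
    rcases le_total n N with h | h
    · exact hFmono t h
    · obtain ⟨k, rfl⟩ := Nat.exists_eq_add_of_le h
      exact (hFeq N t ht k).le
  let U : Set (Lp ℝ ∞ P) := {h | ∀ n, ∫ ω, F n (h ω) ∂P ≤ 1}
  have hUconv : Convex ℝ U := by
    intro h hh g hg a b ha hb hab n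
    refine (integral_comp_convex (hFc n) (hFconv n) h g ha hb hab).trans ?_
    nlinarith [hh n, hg n]
  have hUind : ∀ (N : ℕ) {B : Set Ω} (hB : MeasurableSet B), P.real B * F N N ≤ 1 →
      (N : ℝ) • ind P hB ∈ U := by
    intro N B hB hle n
    have h1 : (fun ω => F n (((N : ℝ) • ind P hB : Lp ℝ ∞ P) ω)) =ᵐ[P]
        B.indicator fun _ => F n N := by
      filter_upwards [Lp.coeFn_smul (N : ℝ) (ind P hB), indicatorConstLp_coeFn (p := ∞) (hs := hB)
        (hμs := measure_ne_top P B) (c := (1 : ℝ))] with ω e1 e2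
      rw [e1, Pi.smul_apply, e2]
      by_cases hω : ω ∈ B
      · simp [hω]
      · simp [hω, hFnonpos n 0 le_rfl]
    rw [integral_congr_ae h1, integral_indicator_const _ hB, smul_eq_mul]
    exact (mul_le_mul_of_nonneg_left (hFle N N le_rfl n) measureReal_nonneg).trans hle
  have hU0 : (0 : Lp ℝ ∞ P) ∈ U := by
    have := hUind 0 MeasurableSet.univ (by simp [hF0])
    simpa using this
  have hconv2 : Convex ℝ {x | x₀ - x ∈ U} := by
    intro x hx y hy a b ha hb hab
    have e : x₀ - (a • x + b • y) = a • (x₀ - x) + b • (x₀ - y) := by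
      rw [smul_sub, smul_sub, sub_add_sub_comm, ← add_smul, hab, one_smul]
    change x₀ - (a • x + b • y) ∈ U
    rw [e]
    exact hUconv hx hy ha hb hab
  have hdisj : Disjoint {X | p X < 0} {x | x₀ - x ∈ U} := by
    rw [Set.disjoint_left]
    intro x hx hxU
    -- The positive part has the same modular, since every `F N` vanishes on `t ≤ 0`, and `x₀ - h ≤
    -- x` keeps `x₀ - h` acceptable; detection at a level above `‖h‖` contradicts membership in `U`.
    let h : Lp ℝ ∞ P := (x₀ - x) ⊔ 0
    have hh : h =ᵐ[P] fun ω => max ((x₀ - x : Lp ℝ ∞ P) ω) 0 := by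
      filter_upwards [Lp.coeFn_sup (x₀ - x) 0, Lp.coeFn_zero ℝ ∞ P] with ω e1 e2
      rw [e1, Pi.sup_apply, e2]; rfl
    obtain ⟨N, hN⟩ := exists_nat_ge ‖h‖
    have h1 := hFd N h le_sup_right
      ((ae_abs_le_norm h).mono fun ω h => ((abs_le.1 h).2.trans hN))
      ((hp.mono _ x (sub_le_comm.1 le_sup_left)).trans (le_of_lt hx))
    have h2 : ∫ ω, F N (h ω) ∂P = ∫ ω, F N ((x₀ - x : Lp ℝ ∞ P) ω) ∂P := by
      refine integral_congr_ae ?_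
      filter_upwards [hh] with ω e1
      rw [e1]
      rcases le_total ((x₀ - x : Lp ℝ ∞ P) ω) 0 with h3 | h3
      · rw [max_eq_right h3, hFnonpos N _ h3, hFnonpos N 0 le_rfl]
      · rw [max_eq_left h3]
    exact absurd (hxU N) (not_le.2 (h2 ▸ h1))
  obtain ⟨f, u, hf1, hf2⟩ := geometric_hahn_banach_open hp.convex_neg hp.isOpen_neg hconv2 hdisj
  let l : Lp ℝ ∞ P →ₗ[ℝ] ℝ := f.toLinearMap
  have hl1 : ∀ X, p X < 0 → l X < u := hf1
  have hl2 : ∀ h ∈ U, u ≤ l x₀ - l h := by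
    intro h hh
    rw [← map_sub]
    exact hf2 _ (show x₀ - (x₀ - h) ∈ U by rwa [sub_sub_cancel])
  have hlx₀ : u ≤ l x₀ := by simpa using hl2 0 hU0
  have hu1 : 0 < l one := by
    have := hl1 (x₀ + (-(2 * e)) • one) (by rw [hp.cash, hpx₀]; linarith)
    rw [map_add, map_smul, smul_eq_mul] at this
    nlinarith
  have hu : 0 ≤ u := by
    by_contra! hneg
    have hd : 0 < -u / l one := div_pos (neg_pos.2 hneg) hu1
    have := hl1 ((-(-u / l one)) • one) (by rw [hp.smul_one]; linarith)
    rw [map_smul, smul_eq_mul, neg_mul, div_mul_cancel₀ _ hu1.ne'] at this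
    linarith
  -- Here homogeneity enters: `{p < 0}` is a cone, so a functional bounded above on it is
  -- nonpositive there.
  have hlneg : ∀ X, p X < 0 → l X ≤ 0 := by
    intro X hX
    by_contra! hpos
    have ht : 0 < (u + 1) / l X := by positivity
    have := hl1 (((u + 1) / l X) • X) (by rw [hom _ _ ht]; exact mul_neg_of_pos_of_neg ht hX)
    rw [map_smul, smul_eq_mul, div_mul_cancel₀ _ hpos.ne'] at this
    linarith
  have hl := hp.le_mul_of_nonpos l hlneg
  have hlA : 0 < l (ind P hA) := by
    have h1 : l x₀ = l (ind P hA) + (-e) * l one := by rw [map_add, map_smul, smul_eq_mul]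
    nlinarith
  obtain ⟨Q, h1, h2, h3, h4⟩ := hp.exists_measure l hu1 hl fun B hB hanti hempty => by
    have hnn : ∀ n, 0 ≤ l (ind P (hB n)) := fun n => hp.nonneg_of_le_mul l hu1.le hl (ind_nonneg _)
    have hPB : Tendsto (fun n => P.real (B n)) atTop (𝓝 0) := by
      have := tendsto_measure_iInter_atTop (μ := P) (fun n => (hB n).nullMeasurableSet) hanti
        ⟨0, measure_ne_top P _⟩
      rw [hempty, measure_empty] at this
      exact (ENNReal.tendsto_toReal ENNReal.zero_ne_top).comp this
    rw [Metric.tendsto_atTop]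
    intro d hd
    -- Once `P (B n)` is small, `N • 1_{B n}` lies in `U`, so separation and `u ≥ 0` give `N * l
    -- (1_{B n}) ≤ l x₀ < N * d`.
    obtain ⟨N, hN⟩ := exists_nat_gt (l x₀ / d)
    have hNpos : (0 : ℝ) < N := lt_of_le_of_lt (div_nonneg (hu.trans hlx₀) hd.le) hN
    have hsmall : ∀ᶠ n in atTop, P.real (B n) * F N N < 1 := by
      have := hPB.mul_const (F N N)
      rw [zero_mul] at this
      exact this.eventually_lt_const zero_lt_one
    obtain ⟨n₀, hn₀⟩ := eventually_atTop.1 hsmall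
    refine ⟨n₀, fun n hn => ?_⟩
    have h5 := hl2 _ (hUind N (hB n) (hn₀ n hn).le)
    rw [map_smul, smul_eq_mul] at h5
    rw [div_lt_iff₀ hd] at hN
    rw [Real.dist_eq, sub_zero, abs_of_nonneg (hnn n)]
    by_contra! hge
    nlinarith
  refine ⟨Q, h1, h2, h3, ?_⟩
  rw [h4]
  exact div_pos hlA hu1

end Sublinear

/-! ### Weak* closures and the separation criterion. -/

section FreeLunch

variable {Ω : Type*} {m : MeasurableSpace Ω} {P : Measure Ω}

/-- The density `dQ/dP` is in `L^1(P)`, so the half-space `{E_Q ≤ 0}` is weak* closed. -/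
theorem integral_le_zero_of_mem_closure [SigmaFinite P] {Q : Measure Ω}
    [IsFiniteMeasure Q] (hQ : Q ≪ P) {S : Set (Lp ℝ ∞ P)} (hS : ∀ X ∈ S, ∫ ω, X ω ∂Q ≤ 0)
    {X : Lp ℝ ∞ P} (hX : X ∈ @closure _ (weakStar P) S) : ∫ ω, X ω ∂Q ≤ 0 := by
  have hint : Integrable (fun ω => (Q.rnDeriv P ω).toReal) P := Measure.integrable_toReal_rnDeriv
  let g : Lp ℝ 1 P := hint.toL1 _
  have hg : g =ᵐ[P] fun ω => (Q.rnDeriv P ω).toReal := hint.coeFn_toL1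
  have hrep : ∀ Y : Lp ℝ ∞ P, ∫ ω, g ω * Y ω ∂P = ∫ ω, Y ω ∂Q := by
    intro Y
    rw [← integral_rnDeriv_smul hQ]
    refine integral_congr_ae ?_
    filter_upwards [hg] with ω h
    rw [h, smul_eq_mul]
  have hcont : @Continuous _ _ (weakStar P) _ fun Y : Lp ℝ ∞ P => ∫ ω, g ω * Y ω ∂P :=
    continuous_iInf_dom (i := g) continuous_induced_dom
  have hclosed : @IsClosed _ (weakStar P) {Y : Lp ℝ ∞ P | ∫ ω, g ω * Y ω ∂P ≤ 0} :=
    @IsClosed.preimage _ _ (weakStar P) _ _ hcont _ isClosed_Iic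
  have := @closure_minimal _ (weakStar P) _ _ (fun Y hY => by
    rw [Set.mem_ofPred_eq, hrep]; exact hS Y hY) hclosed X hX
  rwa [Set.mem_ofPred_eq, hrep] at this

/-- Separation criterion for the absence of free lunches. -/
theorem closure_inter_nonneg_eq [IsFiniteMeasure P] {S : Set (Lp ℝ ∞ P)} (h0 : 0 ∈ S)
    (hS : ∀ (A : Set Ω) (hA : MeasurableSet A), P A ≠ 0 → ∃ Q : Measure Ω,
      IsProbabilityMeasure Q ∧ Q ≪ P ∧ (∀ X ∈ S, ∫ ω, X ω ∂Q ≤ 0) ∧ 0 < ∫ ω, ind P hA ω ∂Q) :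
    @closure _ (weakStar P) S ∩ {X | 0 ≤ X} = {0} := by
  refine Set.Subset.antisymm ?_ (Set.singleton_subset_iff.2
    ⟨@subset_closure _ (weakStar P) S 0 h0, le_refl (0 : Lp ℝ ∞ P)⟩)
  rintro X ⟨hX, hX0⟩
  have hX0' : ∀ᵐ ω ∂P, 0 ≤ X ω := (Lp.coeFn_nonneg X).2 hX0
  have hA : MeasurableSet {ω | 0 < X ω} :=
    measurableSet_lt measurable_const (Lp.stronglyMeasurable X).measurable
  by_contra hne
  have hPA : P {ω | 0 < X ω} ≠ 0 := by
    intro h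
    refine hne ((Lp.eq_zero_iff_ae_eq_zero).2 ?_)
    filter_upwards [hX0', measure_eq_zero_iff_ae_notMem.1 h] with ω h1 h2
    exact le_antisymm (not_lt.1 h2) h1
  obtain ⟨Q, hQ, hac, hneg, hpos⟩ := hS _ hA hPA
  have h1 := integral_le_zero_of_mem_closure hac hneg hX
  have hQ0 : 0 ≤ᵐ[Q] X := hac.ae_le hX0'
  have h2 := (integral_eq_zero_iff_of_nonneg_ae hQ0 (integrable_linfty_of_ac hac X)).1
    (le_antisymm h1 (integral_nonneg_of_ae hQ0))
  have h3 : ∫ ω, ind P hA ω ∂Q = 0 := by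
    refine integral_eq_zero_of_ae ?_
    have h4 : ind P hA =ᵐ[Q] {ω | 0 < X ω}.indicator fun _ => (1 : ℝ) :=
      hac.ae_le indicatorConstLp_coeFn
    filter_upwards [h2, h4] with ω e1 e2
    rw [e2, Set.indicator_of_notMem]
    · rfl
    · change ¬ 0 < X ω
      rw [e1]; simp
  exact hpos.ne' h3

end FreeLunch

/-! ### Triviality of `F_0` modulo `P`. -/

section TrivialSigmaAlgebra

variable {Ω : Type*} {m : MeasurableSpace Ω} {P : Measure Ω}

theorem ae_mem_or_ae_notMem_of_generateFrom_null {A : Set Ω}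
    (hA : MeasurableSet[MeasurableSpace.generateFrom {s : Set Ω | MeasurableSet s ∧ P s = 0}] A) :
    (∀ᵐ ω ∂P, ω ∈ A) ∨ ∀ᵐ ω ∂P, ω ∉ A := by
  induction A, hA using MeasurableSpace.generateFrom_induction with
  | hC t ht _ => exact Or.inr (measure_eq_zero_iff_ae_notMem.1 ht.2)
  | empty => exact Or.inr (by simp)
  | compl t _ ih =>
    rcases ih with h | h
    · exact Or.inr (h.mono fun ω h h' => h' h)
    · exact Or.inl h
  | iUnion s _ ih =>
    by_cases hex : ∃ n, ∀ᵐ ω ∂P, ω ∈ s n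
    · obtain ⟨n, hn⟩ := hex
      exact Or.inl (hn.mono fun ω h => Set.mem_iUnion.2 ⟨n, h⟩)
    · push Not at hex
      have : ∀ᵐ ω ∂P, ∀ n, ω ∉ s n := ae_all_iff.2 fun n =>
        (ih n).resolve_left (not_eventually.2 (hex n))
      exact Or.inr (this.mono fun ω h h' => by
        obtain ⟨n, hn⟩ := Set.mem_iUnion.1 h'
        exact h n hn)

theorem StandingAssumptions.exists_ae_eq_const {𝓕 : Filtration ℝ≥0 m}
    (hF : StandingAssumptions P 𝓕) (Z : LInf P (StopTime.zero 𝓕)) :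
    ∃ c : ℝ, ∀ᵐ ω ∂P, (Z : Lp ℝ ∞ P) ω = c := by
  have hZ := mem_lpMeas_iff_aestronglyMeasurable.1 Z.2
  obtain ⟨g, hg, hZg⟩ := hZ
  obtain ⟨c, hc⟩ := exists_eventuallyEq_const_of_forall_separating (l := ae P) (f := g)
    MeasurableSet fun U hU => by
      have hm : MeasurableSet[𝓕 0] (g ⁻¹' U) := by
        have := (hg.measurable hU).2 0
        have he : {ω | (StopTime.zero 𝓕).1 ω ≤ ((0 : ℝ≥0) : WithTop ℝ≥0)} = Set.univ :=
          Set.eq_univ_of_forall fun ω => le_refl ((0 : ℝ≥0) : WithTop ℝ≥0)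
        rwa [he, Set.inter_univ] at this
      rw [hF.zero_eq] at hm
      exact ae_mem_or_ae_notMem_of_generateFrom_null hm
  exact ⟨c, hZg.trans hc⟩

end TrivialSigmaAlgebra

/-! ### From pricing procedures to scalar functionals, and the absence of free lunches. -/

namespace PricingProcedure

variable {Ω : Type*} {m : MeasurableSpace Ω} {P : Measure Ω} {𝓕 : Filtration ℝ≥0 m}

theorem const_mem_lInf [IsFiniteMeasure P] (σ : StopTime 𝓕) (c : ℝ) :
    c • Lp.const ∞ P (1 : ℝ) ∈ LInf P σ := by
  rw [mem_lpMeas_iff_aestronglyMeasurable]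
  exact (aestronglyMeasurable_const (b := c)).congr (EventuallyEq.symm (coeFn_const_one_smul c))

theorem priceInfty_add (V : PricingProcedure P 𝓕) (σ : StopTime 𝓕) (X : Lp ℝ ∞ P)
    (Z : LInf P σ) : V.priceInfty σ (X + Z) = V.priceInfty σ X + Z := by
  have h := V.translation σ.le_infty Z (LInf.ofLp 𝓕 X)
  exact congrArg Subtype.val h

theorem priceInfty_zero (V : PricingProcedure P 𝓕) (σ : StopTime 𝓕) : V.priceInfty σ 0 = 0 :=
  congrArg Subtype.val (V.normalized σ.le_infty)

theorem priceZeroInfty_eq_zero_of_priceInfty_eq_zero (V : PricingProcedure P 𝓕)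
    (hV : V.TimeConsistent) (τ : StopTime 𝓕) {X : Lp ℝ ∞ P} (h : V.priceInfty τ X = 0) :
    V.priceZeroInfty X = 0 := by
  have h1 : V.price τ.le_infty (LInf.ofLp 𝓕 X) = 0 := Subtype.ext h
  have h2 := hV τ.zero_le τ.le_infty (LInf.ofLp 𝓕 X)
  rw [h1, V.normalized] at h2
  exact (congrArg Subtype.val h2).symm

/-- The price at time `0`, as a number. -/
noncomputable def value (V : PricingProcedure P 𝓕) (X : Lp ℝ ∞ P) : ℝ :=
  ∫ ω, V.priceZeroInfty X ω ∂P

theorem value_nonpos (V : PricingProcedure P 𝓕) {X : Lp ℝ ∞ P} (h : V.priceZeroInfty X ≤ 0) :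
    V.value X ≤ 0 := by
  refine integral_nonpos_of_ae ?_
  filter_upwards [(Lp.coeFn_le _ _).2 h, Lp.coeFn_zero ℝ ∞ P] with ω h1 h2
  rwa [h2] at h1

theorem value_smul (V : PricingProcedure P 𝓕) (hV : V.Sublinear) (t : ℝ) (X : Lp ℝ ∞ P)
    (ht : 0 < t) : V.value (t • X) = t * V.value X := by
  have h := hV (StopTime.zero 𝓕).le_infty t ht (LInf.ofLp 𝓕 X)
  have h' : V.priceZeroInfty (t • X) = t • V.priceZeroInfty X := congrArg Subtype.val h
  rw [value, h', integral_congr_ae (Lp.coeFn_smul t (V.priceZeroInfty X))]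
  simp only [Pi.smul_apply, smul_eq_mul]
  rw [integral_const_mul]; rfl

theorem ae_priceZeroInfty_eq_value [IsProbabilityMeasure P] (V : PricingProcedure P 𝓕)
    (hF : StandingAssumptions P 𝓕) (X : Lp ℝ ∞ P) :
    ∀ᵐ ω ∂P, V.priceZeroInfty X ω = V.value X := by
  obtain ⟨c, hc⟩ := hF.exists_ae_eq_const (V.price (StopTime.zero 𝓕).le_infty (LInf.ofLp 𝓕 X))
  have hc' : ∀ᵐ ω ∂P, V.priceZeroInfty X ω = c := hc
  have : V.value X = c := by
    rw [value, integral_congr_ae hc']; simp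
  rw [this]
  exact hc'

/-- Expectation under `Q ≪ P`, as a linear functional on `L^∞(P)`. -/
noncomputable def expect {Q : Measure Ω} [IsFiniteMeasure Q] (hac : Q ≪ P) :
    Lp ℝ ∞ P →ₗ[ℝ] ℝ where
  toFun X := ∫ ω, X ω ∂Q
  map_add' X Y := by
    rw [integral_congr_ae (hac.ae_le (Lp.coeFn_add X Y))]
    exact integral_add (integrable_linfty_of_ac hac X) (integrable_linfty_of_ac hac Y)
  map_smul' c X := by
    rw [integral_congr_ae (hac.ae_le (Lp.coeFn_smul c X))]
    exact integral_const_mul c _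

theorem expect_mono {Q : Measure Ω} [IsFiniteMeasure Q] (hac : Q ≪ P) {X Y : Lp ℝ ∞ P}
    (h : X ≤ Y) : expect hac X ≤ expect hac Y :=
  integral_mono_ae (integrable_linfty_of_ac hac X) (integrable_linfty_of_ac hac Y)
    (hac.ae_le ((Lp.coeFn_le X Y).2 h))

/-- By translation invariance `X - Π_{τ,∞}(X)` has price zero at `τ`, hence at `0` by
time-consistency; domination makes its `Q`-expectation nonpositive. -/
theorem expect_le_expect_priceInfty (V : PricingProcedure P 𝓕) (hV : V.TimeConsistent)
    {Q : Measure Ω} [IsFiniteMeasure Q] (hac : Q ≪ P) (hQ : ∀ X, expect hac X ≤ V.value X)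
    (τ : StopTime 𝓕) (X : Lp ℝ ∞ P) : expect hac X ≤ expect hac (V.priceInfty τ X) := by
  have h1 : V.priceInfty τ (X - V.priceInfty τ X) = 0 := by
    have h := V.priceInfty_add τ X (-(V.price τ.le_infty (LInf.ofLp 𝓕 X)))
    rw [Submodule.coe_neg, ← sub_eq_add_neg, ← sub_eq_add_neg] at h
    exact h.trans (sub_self _)
  have h2 := V.value_nonpos
    (V.priceZeroInfty_eq_zero_of_priceInfty_eq_zero hV τ h1).le
  have h3 := (hQ _).trans h2
  rw [map_sub] at h3
  linarith

variable [IsProbabilityMeasure P]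

theorem isPriceFunctional_value (V : PricingProcedure P 𝓕) : IsPriceFunctional V.value where
  mono X Y h := by
    have := V.monotone (StopTime.zero 𝓕).le_infty (LInf.ofLp 𝓕 X) (LInf.ofLp 𝓕 Y) h
    exact integral_mono_ae (integrable_linfty _) (integrable_linfty _) ((Lp.coeFn_le _ _).2 this)
  cash X c := by
    have h := V.priceInfty_add (StopTime.zero 𝓕) X ⟨_, const_mem_lInf (StopTime.zero 𝓕) c⟩
    change ∫ ω, V.priceInfty (StopTime.zero 𝓕) _ ω ∂P = _
    rw [h, integral_congr_ae (Lp.coeFn_add _ _)]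
    simp only [Pi.add_apply]
    rw [integral_add (integrable_linfty _) (integrable_linfty _),
      integral_congr_ae (coeFn_const_one_smul (P := P) c)]
    simp [value, priceZeroInfty]
  convex := by
    refine ⟨convex_univ, fun X _ Y _ a b ha hb hab => ?_⟩
    obtain rfl : b = 1 - a := by linarith
    have h := V.convex (StopTime.zero 𝓕).le_infty (LInf.ofLp 𝓕 X) (LInf.ofLp 𝓕 Y) a ha
      (by linarith)
    have h' : V.priceZeroInfty (a • X + (1 - a) • Y) ≤
        a • V.priceZeroInfty X + (1 - a) • V.priceZeroInfty Y := h
    have h2 := integral_mono_ae (integrable_linfty _) (integrable_linfty _)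
      ((Lp.coeFn_le _ _).2 h')
    refine h2.trans_eq ?_
    have h3 : (a • V.priceZeroInfty X + (1 - a) • V.priceZeroInfty Y : Lp ℝ ∞ P) =ᵐ[P]
        fun ω => a * V.priceZeroInfty X ω + (1 - a) * V.priceZeroInfty Y ω := by
      filter_upwards [Lp.coeFn_add (a • V.priceZeroInfty X) ((1 - a) • V.priceZeroInfty Y),
        Lp.coeFn_smul a (V.priceZeroInfty X), Lp.coeFn_smul (1 - a) (V.priceZeroInfty Y)]
        with ω e1 e2 e3
      simp only [e1, e2, e3, Pi.add_apply, Pi.smul_apply, smul_eq_mul]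
    rw [integral_congr_ae h3, integral_add ((integrable_linfty _).const_mul _)
      ((integrable_linfty _).const_mul _), integral_const_mul, integral_const_mul]
    rfl
  zero := by
    change ∫ ω, V.priceInfty (StopTime.zero 𝓕) 0 ω ∂P = 0
    rw [V.priceInfty_zero, integral_congr_ae (Lp.coeFn_zero ℝ ∞ P)]
    simp

theorem priceZeroInfty_eq_zero (V : PricingProcedure P 𝓕) (hF : StandingAssumptions P 𝓕)
    {X : Lp ℝ ∞ P} (h : V.value X = 0) : V.priceZeroInfty X = 0 := by
  rw [Lp.eq_zero_iff_ae_eq_zero]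
  filter_upwards [V.ae_priceZeroInfty_eq_value hF X] with ω h1
  rw [h1, h]; rfl

theorem tendsto_value (V : PricingProcedure P 𝓕) (hF : StandingAssumptions P 𝓕)
    {Xn : ℕ → Lp ℝ ∞ P} {X : Lp ℝ ∞ P}
    (h : ∀ᵐ ω ∂P, Tendsto (fun n => V.priceZeroInfty (Xn n) ω) atTop
      (𝓝 (V.priceZeroInfty X ω))) :
    Tendsto (fun n => V.value (Xn n)) atTop (𝓝 (V.value X)) := by
  have hall : ∀ᵐ ω ∂P, ∀ n, V.priceZeroInfty (Xn n) ω = V.value (Xn n) :=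
    ae_all_iff.2 fun n => V.ae_priceZeroInfty_eq_value hF (Xn n)
  -- A single `ω` outside the exceptional null sets turns a.e. convergence of constants into
  -- convergence of numbers.
  obtain ⟨ω, h1, h2, h3⟩ := (h.and (hall.and (V.ae_priceZeroInfty_eq_value hF X))).exists
  simp only [h2, h3] at h1
  exact h1

theorem continuousBelow_value (V : PricingProcedure P 𝓕) (hF : StandingAssumptions P 𝓕)
    (hV : V.ContinuousFromBelow) : ContinuousBelow V.value := fun Xn X hm hX =>
  V.tendsto_value hF (hV (StopTime.zero 𝓕).le_infty (fun n => LInf.ofLp 𝓕 (Xn n))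
    (LInf.ofLp 𝓕 X) hm hX)

theorem continuousAbove_value (V : PricingProcedure P 𝓕) (hF : StandingAssumptions P 𝓕)
    (hV : V.ContinuousFromAbove) : ContinuousAbove V.value := fun Xn X hm hX =>
  V.tendsto_value hF (hV (StopTime.zero 𝓕).le_infty (fun n => LInf.ofLp 𝓕 (Xn n))
    (LInf.ofLp 𝓕 X) hm hX)

/-- Domination of a family of expectations by the price at time `0` excludes free lunches. -/
theorem noFreeLunch_of_forall_exists (V : PricingProcedure P 𝓕) (hV : V.TimeConsistent)
    (h : ∀ (A : Set Ω) (hA : MeasurableSet A), P A ≠ 0 → ∃ Q : Measure Ω,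
      IsProbabilityMeasure Q ∧ Q ≪ P ∧ (∀ X : Lp ℝ ∞ P, ∫ ω, X ω ∂Q ≤ V.value X) ∧
        0 < ∫ ω, ind P hA ω ∂Q) :
    V.NoFreeLunch := by
  have hzero : V.priceZeroInfty 0 ≤ 0 := (V.priceInfty_zero (StopTime.zero 𝓕)).le
  constructor
  · refine closure_inter_nonneg_eq ⟨0, 0, le_rfl, hzero, by simp⟩ fun A hA hPA => ?_
    obtain ⟨Q, hQ, hac, hle, hpos⟩ := h A hA hPA
    refine ⟨Q, hQ, hac, ?_, hpos⟩
    rintro _ ⟨l, X, hl, hX, rfl⟩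
    change expect hac (l • X) ≤ 0
    rw [map_smul, smul_eq_mul]
    exact mul_nonpos_of_nonneg_of_nonpos hl ((hle X).trans (V.value_nonpos hX))
  · refine closure_inter_nonneg_eq ⟨0, 0, le_rfl, ⟨0, Fin.elim0, 0, Fin.elim0, Fin.elim0,
      fun i => i.elim0, fun i => i.elim0, hzero, fun i => i.elim0, by simp⟩, by simp⟩
      fun A hA hPA => ?_
    obtain ⟨Q, hQ, hac, hle, hpos⟩ := h A hA hPA
    refine ⟨Q, hQ, hac, ?_, hpos⟩
    rintro _ ⟨l, _, hl, ⟨n, τ, X₀, Y, Z, -, -, hX₀, hYZ, rfl⟩, rfl⟩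
    change expect hac (l • (X₀ + ∑ i, (Z i - Y i))) ≤ 0
    rw [map_smul, smul_eq_mul, map_add, map_sum]
    refine mul_nonpos_of_nonneg_of_nonpos hl
      (add_nonpos ((hle X₀).trans (V.value_nonpos hX₀)) (Finset.sum_nonpos fun i _ => ?_))
    -- The trade satisfies `E_Q(Z i - Y i) ≤ E_Q(Π(Z i) + Π(-Y i)) ≤ 0`, with `Π` the price at `τ
    -- i`.
    have h1 := V.expect_le_expect_priceInfty hV hac hle (τ i) (Z i)
    have h2 := V.expect_le_expect_priceInfty hV hac hle (τ i) (-(Y i))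
    have h3 := expect_mono hac (hYZ i)
    rw [map_neg] at h2 h3
    rw [map_sub]
    linarith

/-- Only the upper-bound half of the essential supremum matters: it gives `E_Q(X | F_0) ≤
Π_{0,∞}(X)`, to be integrated under `Q`. -/
theorem integral_le_value_of_hasZeroMinimalPenalty (V : PricingProcedure P 𝓕)
    (hF : StandingAssumptions P 𝓕) {Q : Measure Ω} [IsProbabilityMeasure Q] (hac : Q ≪ P)
    (hQ : V.HasZeroMinimalPenalty Q) (X : Lp ℝ ∞ P) : ∫ ω, X ω ∂Q ≤ V.value X := by
  have h1 := hQ.2.1 _ ⟨LInf.ofLp 𝓕 X, rfl⟩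
  have h2 : ∀ᵐ ω ∂Q, V.priceZeroInfty X ω = V.value X :=
    hac.ae_le (V.ae_priceZeroInfty_eq_value hF X)
  rw [← integral_condExp (StopTime.zero 𝓕).sigmaAlgebra_le]
  have h3 : ∀ᵐ ω ∂Q, (Q[X | (StopTime.zero 𝓕).sigmaAlgebra]) ω ≤ V.value X := by
    filter_upwards [h1, h2] with ω e1 e2
    have e3 : (Q[X | (StopTime.zero 𝓕).sigmaAlgebra]) ω - V.priceZeroInfty X ω ≤ 0 :=
      EReal.coe_le_coe_iff.1 e1
    linarith
  have h4 := integral_mono_ae integrable_condExp (integrable_const _) h3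
  simpa using h4

/-- If `Q A = 0`, then `0 = E_Q(-l 1_A) ≤ p (-l 1_A) ≤ 0` for all `l > 0`, so non-degeneracy gives
`P A = 0`; one `Q` serves all events. -/
theorem noFreeLunch_of_nonDegenerate (V : PricingProcedure P 𝓕)
    (hF : StandingAssumptions P 𝓕) (hV : V.TimeConsistent) (hnd : V.NonDegenerate)
    {Q : Measure Ω} [IsProbabilityMeasure Q] (hac : Q ≪ P)
    (hQ : ∀ X : Lp ℝ ∞ P, ∫ ω, X ω ∂Q ≤ V.value X) : V.NoFreeLunch := by
  refine V.noFreeLunch_of_forall_exists hV fun A hA hPA => ⟨Q, ‹_›, hac, hQ, ?_⟩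
  have hnn : 0 ≤ expect hac (ind P hA) := by
    simpa using expect_mono hac (ind_nonneg (P := P) hA)
  refine lt_of_le_of_ne hnn fun h0 => hPA (hnd A hA fun l hl => ?_)
  change 0 = expect hac _ at h0
  refine V.priceZeroInfty_eq_zero hF (le_antisymm ?_ ?_)
  · rw [← V.isPriceFunctional_value.zero]
    exact V.isPriceFunctional_value.mono _ _
      (neg_nonpos.2 (smul_nonneg_linfty hl.le (ind_nonneg hA)))
  · have h1 : expect hac (-(l • ind P hA)) ≤ _ := hQ _
    rwa [map_neg, map_smul, ← h0, smul_zero, neg_zero] at h1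

theorem noFreeLunch_of_askNonDegenerate (V : PricingProcedure P 𝓕)
    (hF : StandingAssumptions P 𝓕) (hV : V.IsTCPP) (hnd : V.AskNonDegenerate)
    (hsub : V.Sublinear) : V.NoFreeLunch := by
  refine V.noFreeLunch_of_forall_exists hV.timeConsistent fun A hA hPA => ?_
  have hp := V.isPriceFunctional_value
  refine hp.exists_measure_pos (V.continuousBelow_value hF hV.continuousFromBelow)
    (V.value_smul hsub) hA ?_
  have hnn : 0 ≤ V.value (ind P hA) := by
    rw [← hp.zero]
    exact hp.mono _ _ (ind_nonneg hA)
  refine lt_of_le_of_ne hnn fun h0 => hPA (hnd A hA fun l hl => ?_)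
  exact V.priceZeroInfty_eq_zero hF (by rw [V.value_smul hsub l _ hl, ← h0, mul_zero])

/-- The midpoint of `X` and `-X` is `0`, so convexity gives `p X + p (-X) ≥ 0`: the bid never
exceeds the ask, and a zero ask forces a zero bid. -/
theorem NonDegenerate.askNonDegenerate {V : PricingProcedure P 𝓕}
    (hF : StandingAssumptions P 𝓕) (hnd : V.NonDegenerate) : V.AskNonDegenerate := by
  intro A hA h
  have hp := V.isPriceFunctional_value
  refine hnd A hA fun l hl => V.priceZeroInfty_eq_zero hF (le_antisymm ?_ ?_)
  · rw [← hp.zero]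
    exact hp.mono _ _ (neg_nonpos.2 (smul_nonneg_linfty hl.le (ind_nonneg hA)))
  · have h1 : V.value (l • ind P hA) ≤ 0 := V.value_nonpos (h l hl).le
    have h2 := hp.convex.2 (Set.mem_univ (l • ind P hA)) (Set.mem_univ (-(l • ind P hA)))
      (show (0 : ℝ) ≤ 1 / 2 by norm_num) (show (0 : ℝ) ≤ 1 / 2 by norm_num) (by norm_num)
    rw [smul_neg, add_neg_cancel, hp.zero, smul_eq_mul, smul_eq_mul] at h2
    linarith

end PricingProcedure

end DynPricing

theorem mainTheorem7 {Ω : Type*} {m : MeasurableSpace Ω} (P : Measure Ω) [IsProbabilityMeasure P]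
    (𝓕 : Filtration ℝ≥0 m) (hF : DynPricing.StandingAssumptions P 𝓕)
    (V : DynPricing.PricingProcedure P 𝓕) (hV : V.IsTCPP) :
    (V.NonDegenerate →
      (∃ Q : Measure Ω, IsProbabilityMeasure Q ∧ Q ≪ P ∧ V.HasZeroMinimalPenalty Q) →
      V.NoFreeLunch) ∧
    (V.NonDegenerate → V.Sublinear → V.NoFreeLunch) ∧
    (V.NonDegenerate → V.ContinuousFromAbove → V.NoFreeLunch) ∧
    (V.AskNonDegenerate → V.Sublinear → V.NoFreeLunch) := by
  refine ⟨fun hnd ⟨Q, hQ, hac, hpen⟩ => ?_, fun hnd hsub => ?_, fun hnd hca => ?_,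
    fun hnd hsub => V.noFreeLunch_of_askNonDegenerate hF hV hnd hsub⟩
  · exact V.noFreeLunch_of_nonDegenerate hF hV.timeConsistent hnd hac
      (V.integral_le_value_of_hasZeroMinimalPenalty hF hac hpen)
  · exact V.noFreeLunch_of_askNonDegenerate hF hV (hnd.askNonDegenerate hF) hsub
  · obtain ⟨Q, hQ, hac, hle⟩ := V.isPriceFunctional_value.exists_measure_of_continuousAbove
      (V.continuousAbove_value hF hca)
    exact V.noFreeLunch_of_nonDegenerate hF hV.timeConsistent hnd hac hle
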